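/- Let $G$ be a finite simple graph with $n$ vertices. Let $\mathrm{lpt}(G)$ (respectively $\mathrm{lct}(G)$) denote the minimum size of a set of vertices of $G$ that intersects the vertex set of every longest path (respectively every longest cycle) of $G$. Call $G$ 2-connected if $n \ge 2$ and $G - S$ is connected for every set $S$ of fewer than 2 vertices. If $G$ is connected, then $\mathrm{lpt}(G) \le 8n^{3/4}$. If $G$ is 2-connected, then $\mathrm{lct}(G) \le 20n^{3/4}$. -/

import Mathlib

namespace SimpleGraph

/-- A longest path: a path whose length (number of edges) is maximum among all paths of `G`.
A single vertex is a path of length `0`. -/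
def IsLongestPath {V : Type*} (G : SimpleGraph V) {u v : V} (p : G.Walk u v) : Prop :=
  p.IsPath ∧ ∀ (x y : V) (q : G.Walk x y), q.IsPath → q.length ≤ p.length

/-- A longest cycle: a cycle whose length is maximum among all cycles of `G`.
(`Walk.IsCycle` forces a cycle of a simple graph to have at least three vertices.) -/
def IsLongestCycle {V : Type*} (G : SimpleGraph V) {u : V} (c : G.Walk u u) : Prop :=
  c.IsCycle ∧ ∀ (x : V) (d : G.Walk x x), d.IsCycle → d.length ≤ c.length

/-- A longest path transversal (Gallai set): a set of vertices meeting every longest path. -/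
def IsLongestPathTransversal {V : Type*} (G : SimpleGraph V) (S : Finset V) : Prop :=
  ∀ (u v : V) (p : G.Walk u v), G.IsLongestPath p → ∃ x ∈ S, x ∈ p.support

/-- A longest cycle transversal: a set of vertices meeting every longest cycle. -/
def IsLongestCycleTransversal {V : Type*} (G : SimpleGraph V) (S : Finset V) : Prop :=
  ∀ (u : V) (c : G.Walk u u), G.IsLongestCycle c → ∃ x ∈ S, x ∈ c.support

/-- `lpt G` is the minimum size of a longest path transversal. -/
noncomputable def lpt {V : Type*} (G : SimpleGraph V) : ℕ :=
  sInf {k | ∃ S : Finset V, G.IsLongestPathTransversal S ∧ S.card = k}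

/-- `lct G` is the minimum size of a longest cycle transversal. -/
noncomputable def lct {V : Type*} (G : SimpleGraph V) : ℕ :=
  sInf {k | ∃ S : Finset V, G.IsLongestCycleTransversal S ∧ S.card = k}

/-- In a finite graph the minimum defining `lpt` is attained. -/
theorem exists_card_eq_lpt {V : Type*} [Fintype V] (G : SimpleGraph V) :
    ∃ S : Finset V, G.IsLongestPathTransversal S ∧ S.card = G.lpt :=
  Nat.sInf_mem (s := {k | ∃ S : Finset V, G.IsLongestPathTransversal S ∧ S.card = k})
    ⟨_, Finset.univ, fun u _ p _ => ⟨u, Finset.mem_univ u, p.start_mem_support⟩, rfl⟩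

/-- In a finite graph the minimum defining `lct` is attained. -/
theorem exists_card_eq_lct {V : Type*} [Fintype V] (G : SimpleGraph V) :
    ∃ S : Finset V, G.IsLongestCycleTransversal S ∧ S.card = G.lct :=
  Nat.sInf_mem (s := {k | ∃ S : Finset V, G.IsLongestCycleTransversal S ∧ S.card = k})
    ⟨_, Finset.univ, fun u c _ => ⟨u, Finset.mem_univ u, c.start_mem_support⟩, rfl⟩

/-- `G` is `k`-connected: it has at least `k` vertices, and deleting fewer than `k` vertices
always leaves a connected graph. -/
def IsKConnected {V : Type*} [Fintype V] (G : SimpleGraph V) (k : ℕ) : Prop :=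
  k ≤ Fintype.card V ∧
    ∀ S : Finset V, S.card < k → (G.induce {v : V | v ∉ S}).Connected

end SimpleGraph

/-! Let `N` be the transversal number and `n` the order of the graph. Any two longest paths of a
connected graph meet, and so do any two longest cycles of a 2-connected one. Hence their vertex sets
form a family of connected, pairwise intersecting sets that no set of fewer than `N` vertices meets
entirely (`IsElusive`). Such a family acts like a tangle: every set of fewer than `N` vertices is
avoided by some member, and all members avoiding it lie on the same side of it. A set that cannot be
cut off from this side by fewer than `r` vertices is `Linked`, and Menger's theorem joins any two
such sets by `r` disjoint paths.

Suppose `N ^ 4 > 4096 * n ^ 3` and put `w = √n + 1`, rounded down. Cut one member into stretches of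
`N / 3` vertices. Two of them are highly linked, for otherwise few vertices would meet every member
(`IsElusive.exists_linked_of_cover`). Join these two by `4 * w + 1` disjoint paths. Two of the
paths, far apart in the order of their ends on the first stretch, have fewer than `w` inner
vertices. With pieces of the two stretches they form a cycle `O` of fewer than `N` vertices that
meets more than `2 * w` of the paths and is therefore linked itself
(`IsElusive.exists_linked_cycle`).

Some member `S` avoids `O`, and `w + 1` disjoint paths join `O` to `S`. By pigeonhole, two of their
ends on `S` have fewer than `w` vertices of `S` between them, whereas the route through the longer
arc of `O` has more. This detour lengthens `S`, which is impossible (`IsElusive.false_of_cycle`). -/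

namespace SimpleGraph

/-! ### Paths as lists of vertices -/

variable {V : Type*}

/-- The vertex sequence of a path. -/
def PathList (G : SimpleGraph V) (l : List V) : Prop := l.IsChain G.Adj ∧ l.Nodup

theorem PathList.mono {G H : SimpleGraph V} (h : G ≤ H) {l : List V} (hl : G.PathList l) :
    H.PathList l := ⟨hl.1.imp fun _ _ hab => h hab, hl.2⟩

theorem PathList.infix {G : SimpleGraph V} {l m : List V} (hl : G.PathList l) (h : m <:+: l) :
    G.PathList m := ⟨hl.1.infix h, hl.2.sublist h.sublist⟩

theorem PathList.reverse {G : SimpleGraph V} {l : List V} (hl : G.PathList l) :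
    G.PathList l.reverse :=
  ⟨by rw [List.isChain_reverse]; exact hl.1.imp fun _ _ h => h.symm, List.nodup_reverse.2 hl.2⟩

theorem pathList_append_cons {G : SimpleGraph V} {l m : List V} {a : V} :
    G.PathList (l ++ a :: m) ↔
      G.PathList (l ++ [a]) ∧ G.PathList (a :: m) ∧ l.Disjoint m := by
  unfold PathList
  rw [List.isChain_split]
  constructor
  · rintro ⟨⟨h1, h2⟩, h3⟩
    grind [List.nodup_append, List.Disjoint]
  · rintro ⟨⟨h1, h2⟩, ⟨h3, h4⟩, h5⟩
    refine ⟨⟨h1, h3⟩, ?_⟩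
    grind [List.nodup_append, List.Disjoint]

theorem head?_append_cons (l m : List V) (a : V) : (l ++ a :: m).head? = (l ++ [a]).head? := by
  cases l <;> rfl

theorem getLast?_append_reverse (l : List V) {m : List V} (hm : m ≠ []) :
    (l ++ m.reverse).getLast? = m.head? := by
  obtain ⟨a, m, rfl⟩ := List.exists_cons_of_ne_nil hm
  simp

/-- A list with a member in `B` splits at its first member in `B`. -/
theorem exists_first_split (B : Set V) {l : List V} (h : ∃ x ∈ l, x ∈ B) :
    ∃ l₁ b l₂, l = l₁ ++ b :: l₂ ∧ b ∈ B ∧ ∀ x ∈ l₁, x ∉ B := by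
  induction l with
  | nil => simp at h
  | cons a t ih =>
    by_cases ha : a ∈ B
    · exact ⟨[], a, t, rfl, ha, by simp⟩
    · obtain ⟨l₁, b, l₂, rfl, hb, hl⟩ := ih (by grind)
      exact ⟨a :: l₁, b, l₂, rfl, hb, by grind⟩

/-- A list with a member in `B` splits at its last member in `B`. -/
theorem exists_last_split (B : Set V) {l : List V} (h : ∃ x ∈ l, x ∈ B) :
    ∃ l₁ b l₂, l = l₁ ++ b :: l₂ ∧ b ∈ B ∧ ∀ x ∈ l₂, x ∉ B := by
  obtain ⟨l₁, b, l₂, h1, hb, hl⟩ := exists_first_split B (l := l.reverse) (by simpa using h)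
  refine ⟨l₂.reverse, b, l₁.reverse, ?_, hb, by simpa using hl⟩
  have := congrArg List.reverse h1
  simpa using this

/-- A chain starting in `W` which only meets vertices of `K` stays in `W`, provided that
edges inside `K` do not leave `W`. -/
theorem chain_subset_of_closed {G : SimpleGraph V} {W K : Set V}
    (hW : ∀ u ∈ W, ∀ v ∈ K, G.Adj u v → v ∈ W) {l : List V} (hl : l.IsChain G.Adj)
    (hK : ∀ x ∈ l, x ∈ K) (h0 : ∀ x ∈ l.head?, x ∈ W) : ∀ x ∈ l, x ∈ W := by
  induction l with
  | nil => simp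
  | cons a t ih =>
    have ha : a ∈ W := h0 a (by simp)
    rw [List.isChain_cons] at hl
    have := ih hl.2 (by grind) (fun x hx => hW a ha x (hK x (by
      have := List.mem_of_mem_head? hx; grind)) (hl.1 x hx))
    grind

/-! ### Menger's theorem for two vertex sets -/

/-- A path from `A` to `B`, as a list. -/
def PathBetween (G : SimpleGraph V) (A B : Finset V) (l : List V) : Prop :=
  G.PathList l ∧ (∃ a ∈ A, a ∈ l.head?) ∧ ∃ b ∈ B, b ∈ l.getLast?

/-- `X` and `Y` cover the graph, and no edge joins `X \ Y` to `Y \ X`. -/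
def IsSeparation [Fintype V] (G : SimpleGraph V) (X Y : Finset V) : Prop :=
  (∀ v, v ∈ X ∨ v ∈ Y) ∧ ∀ u v, G.Adj u v → u ∈ X → u ∉ Y → v ∈ X

theorem IsSeparation.symm [Fintype V] {G : SimpleGraph V} {X Y : Finset V}
    (h : G.IsSeparation X Y) : G.IsSeparation Y X :=
  ⟨fun v => (h.1 v).symm, fun u v huv hu hu' => by
    by_contra hv
    exact hu' (h.2 v u huv.symm ((h.1 v).resolve_right hv) hv)⟩

open Classical in
-- One side of the inductive step of Menger's theorem, where `G'` is `G` without the edge `xy` and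
-- `(X, Y)` is a separation of `G'` of order `r - 1` that `xy` crosses. The `r` paths end in `X ∩ Y`
-- together with `x`, one at each vertex. Exchanging the roles of `A, X, x` and `B, Y, y` gives the
-- other side.
theorem menger_half [Fintype V] {G G' : SimpleGraph V} {A B X Y : Finset V} {x y : V} {r : ℕ}
    (hGG' : ∀ u v, G.Adj u v → G'.Adj u v ∨ (u = x ∧ v = y) ∨ (u = y ∧ v = x))
    (hcut : ∀ X Y : Finset V, A ⊆ X → B ⊆ Y → G.IsSeparation X Y → r ≤ (X ∩ Y).card)
    (ih : ∀ (A B : Finset V) (r : ℕ),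
      (∀ X Y : Finset V, A ⊆ X → B ⊆ Y → G'.IsSeparation X Y → r ≤ (X ∩ Y).card) →
      ∃ f : Fin r → List V, (∀ i, G'.PathBetween A B (f i)) ∧
        Pairwise fun i j => (f i).Disjoint (f j))
    (hA : A ⊆ X) (hB : B ⊆ Y) (hXY : G'.IsSeparation X Y) (hcard : (X ∩ Y).card + 1 = r)
    (hxX : x ∈ X) (hxY : x ∉ Y) (hyY : y ∈ Y) :
    ∃ g : V → List V, (∀ s ∈ insert x (X ∩ Y), G'.PathList (g s ++ [s]) ∧
        (∃ a ∈ A, a ∈ (g s ++ [s]).head?) ∧ ∀ v ∈ g s, v ∈ X ∧ v ∉ Y ∧ v ≠ x) ∧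
      ∀ s ∈ insert x (X ∩ Y), ∀ t ∈ insert x (X ∩ Y), s ≠ t → (g s).Disjoint (g t) := by
  set S := insert x (X ∩ Y) with hS
  have hScard : S.card = r := by
    rw [hS, Finset.card_insert_of_notMem (by simp [hxY]), hcard]
  -- A separation `(X₁, Y₁)` of `A` from `S` in `G'` yields the separation `(X₁ ∩ X, Y₁ ∪ Y)` of `A`
  -- from `B` in `G`, of no larger order. The edge `xy` does no harm, as both its ends lie in `Y₁ ∪
  -- Y`.
  obtain ⟨f, hf, hdis⟩ := ih A S r (by
    intro X₁ Y₁ hA₁ hS₁ h₁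
    have hsub : (X₁ ∩ X) ∩ (Y₁ ∪ Y) ⊆ X₁ ∩ Y₁ := by
      intro v hv
      have : v ∈ S → v ∈ Y₁ := fun h => hS₁ h
      simp only [hS, Finset.mem_insert, Finset.mem_inter, Finset.mem_union] at this hv ⊢
      tauto
    refine (hcut (X₁ ∩ X) (Y₁ ∪ Y) (Finset.subset_inter hA₁ hA)
      (hB.trans Finset.subset_union_right) ⟨fun v => ?_, fun u v huv hu hu' => ?_⟩).trans
      (Finset.card_le_card hsub)
    · have := h₁.1 v
      have := hXY.1 v
      simp only [Finset.mem_inter, Finset.mem_union]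
      tauto
    · simp only [Finset.mem_inter, Finset.mem_union, not_or] at hu hu' ⊢
      rcases hGG' u v huv with h | ⟨rfl, rfl⟩ | ⟨rfl, rfl⟩
      · exact ⟨h₁.2 u v h hu.1 hu'.1, hXY.2 u v h hu.2 hu'.2⟩
      · exact absurd (hS₁ (by simp [hS])) hu'.1
      · exact absurd hyY hu'.2)
  have hsplit : ∀ i, ∃ l s l', f i = l ++ s :: l' ∧ s ∈ S ∧ ∀ v ∈ l, v ∉ S := fun i => by
    obtain ⟨b, hb, hb'⟩ := (hf i).2.2
    obtain ⟨l, s, l', h1, h2, h3⟩ := exists_first_split (S : Set V) (l := f i)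
      ⟨b, List.mem_of_mem_getLast? hb', hb⟩
    exact ⟨l, s, l', h1, by simpa using h2, by simpa using h3⟩
  choose l s l' hl hs hlS using hsplit
  have hinj : Function.Injective s := by
    intro i j hij
    by_contra hne
    have : (f i).Disjoint (f j) := hdis hne
    rw [hl i, hl j] at this
    exact this (a := s i) (by simp) (by simp [hij])
  -- There are as many disjoint paths as vertices of `S`, so every vertex of `S` is the first one in
  -- `S` on exactly one path.
  have himg : Finset.univ.image s = S := by
    refine Finset.eq_of_subset_of_card_le (by intro v; simp; rintro i rfl; exact hs i) ?_
    rw [Finset.card_image_of_injective _ hinj, hScard]; simp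
  have hsurj : ∀ t ∈ S, ∃ i, s i = t := by
    intro t ht; rw [← himg] at ht; simpa using ht
  have : Nonempty (Fin r) := ⟨⟨0, by omega⟩⟩
  choose! idx hidx using hsurj
  refine ⟨fun t => l (idx t), fun t ht => ?_, fun t ht u hu htu => ?_⟩
  · have h1 := hf (idx t)
    have h2 : f (idx t) = l (idx t) ++ t :: l' (idx t) := by
      conv_lhs => rw [hl (idx t), hidx t ht]
    have hp : G'.PathList (l (idx t) ++ [t]) := by
      have := h1.1; rw [h2, pathList_append_cons] at this; exact this.1
    have hhead : ∃ a ∈ A, a ∈ (l (idx t) ++ [t]).head? := by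
      obtain ⟨a, ha, h⟩ := h1.2.1
      refine ⟨a, ha, ?_⟩
      rw [h2] at h
      cases h' : l (idx t) <;> simp_all
    refine ⟨hp, hhead, ?_⟩
    have := chain_subset_of_closed (G := G') (W := {v | v ∈ X ∧ v ∉ Y}) (K := {v | v ∉ S})
      (by
        rintro u ⟨hu, hu'⟩ v hv huv
        have h := hXY.2 u v huv hu hu'
        refine ⟨h, fun hvY => hv ?_⟩
        simp [hS, h, hvY]) (l := l (idx t)) (hp.1.left_of_append) (hlS _) (by
        intro a ha
        obtain ⟨a', ha', h⟩ := hhead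
        have haa : a = a' := by
          cases h' : l (idx t) <;> simp_all
        subst haa
        have h3 := hlS (idx t) a (List.mem_of_mem_head? ha)
        refine ⟨hA ha', fun hY => h3 ?_⟩
        simp [hS, hA ha', hY])
    intro v hv
    refine ⟨(this v hv).1, (this v hv).2, ?_⟩
    rintro rfl
    exact hlS _ _ hv (by simp [hS])
  · have hne : idx t ≠ idx u := fun h => htu (by rw [← hidx t ht, ← hidx u hu, h])
    have : (f (idx t)).Disjoint (f (idx u)) := hdis hne
    rw [hl (idx t), hl (idx u)] at this
    intro v hv hv'
    exact this (a := v) (by simp [hv]) (by simp [hv'])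

open Classical in
/-- **Menger's theorem**, vertex version for two sets. -/
theorem menger [Fintype V] (G : SimpleGraph V) : ∀ (A B : Finset V) (r : ℕ),
    (∀ X Y : Finset V, A ⊆ X → B ⊆ Y → G.IsSeparation X Y → r ≤ (X ∩ Y).card) →
    ∃ f : Fin r → List V, (∀ i, G.PathBetween A B (f i)) ∧
      Pairwise fun i j => (f i).Disjoint (f j) := by
  induction G using WellFoundedLT.induction with
  | ind G ih =>
  intro A B r hcut
  by_cases hG : G = ⊥
  · subst hG
    have h := hcut A (Aᶜ ∪ B) le_rfl Finset.subset_union_right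
      ⟨fun v => by by_cases v ∈ A <;> simp [*], fun u v huv => by simp at huv⟩
    have h' : A ∩ (Aᶜ ∪ B) = A ∩ B := by ext v; simp; tauto
    rw [h'] at h
    obtain ⟨e⟩ : Nonempty (Fin r ↪ (A ∩ B : Finset V)) :=
      Function.Embedding.nonempty_of_card_le (by rw [Fintype.card_coe]; simpa using h)
    refine ⟨fun i => [(e i : V)], fun i => ?_, fun i j hij => ?_⟩
    · have := (e i).2
      rw [Finset.mem_inter] at this
      exact ⟨⟨by simp, by simp⟩, ⟨_, this.1, by simp⟩, ⟨_, this.2, by simp⟩⟩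
    · have : (e i : V) ≠ e j := fun h => hij (e.injective (Subtype.ext h))
      simpa using this.symm
  · obtain ⟨x₀, y₀, h₀⟩ : ∃ x y, G.Adj x y := by
      by_contra! h
      exact hG (by ext u v; simp [h u v])
    set G' := G.deleteEdges {s(x₀, y₀)} with hG'
    have hlt : G' < G := by
      refine lt_of_le_of_ne (deleteEdges_le _) fun h => ?_
      have : G'.Adj x₀ y₀ := by rw [h]; exact h₀
      simp [hG'] at this
    by_cases hc : ∀ X Y : Finset V, A ⊆ X → B ⊆ Y → G'.IsSeparation X Y → r ≤ (X ∩ Y).card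
    · obtain ⟨f, hf, hd⟩ := ih G' hlt A B r hc
      exact ⟨f, fun i => ⟨(hf i).1.mono hlt.le, (hf i).2⟩, hd⟩
    · push Not at hc
      obtain ⟨X, Y, hA, hB, hXY, hlt'⟩ := hc
      obtain ⟨x, y, hxy, hGG', hxX, hxY, hyY, hyX⟩ : ∃ x y, G.Adj x y ∧
          (∀ u v, G.Adj u v → G'.Adj u v ∨ (u = x ∧ v = y) ∨ (u = y ∧ v = x)) ∧
          x ∈ X ∧ x ∉ Y ∧ y ∈ Y ∧ y ∉ X := by
        have hdel : ∀ u v, G.Adj u v → ¬ G'.Adj u v →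
            (u = x₀ ∧ v = y₀) ∨ (u = y₀ ∧ v = x₀) := by
          intro u v huv h
          have h2 : s(u, v) ∈ ({s(x₀, y₀)} : Set (Sym2 V)) := by
            by_contra hn
            exact h (by rw [hG', deleteEdges_adj]; exact ⟨huv, hn⟩)
          rwa [Set.mem_singleton_iff, Sym2.eq_iff] at h2
        have hns : ¬ G.IsSeparation X Y := fun h => by
          have := hcut X Y hA hB h; omega
        have : ∃ u v, G.Adj u v ∧ u ∈ X ∧ u ∉ Y ∧ v ∉ X := by
          by_contra! h
          exact hns ⟨hXY.1, fun u v huv hu hu' => h u v huv hu hu'⟩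
        obtain ⟨u, v, huv, hu, hu', hv⟩ := this
        have hnadj : ¬ G'.Adj u v := fun h => hv (hXY.2 u v h hu hu')
        have hvY := (hXY.1 v).resolve_left hv
        refine ⟨u, v, huv, fun a b hab => ?_, hu, hu', hvY, hv⟩
        by_cases hab' : G'.Adj a b
        · exact Or.inl hab'
        · rcases hdel a b hab hab' with ⟨rfl, rfl⟩ | ⟨rfl, rfl⟩ <;>
          rcases hdel u v huv hnadj with ⟨rfl, rfl⟩ | ⟨rfl, rfl⟩ <;> simp
      -- Adding `y` to `X` puts both ends of the crossing edge on one side, so a separation of `G`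
      -- results.
      have hle : r ≤ (X ∩ Y).card + 1 := by
        have h1 := hcut (insert y X) Y (hA.trans (Finset.subset_insert _ _)) hB
          ⟨fun v => by have := hXY.1 v; simp; tauto, fun u v huv hu hu' => by
            have hu2 : u ∈ X := by
              rcases Finset.mem_insert.1 hu with rfl | h
              · exact absurd hyY hu'
              · exact h
            rcases hGG' u v huv with h | ⟨rfl, rfl⟩ | ⟨rfl, rfl⟩
            · exact Finset.mem_insert_of_mem (hXY.2 u v h hu2 hu')
            · simp
            · exact absurd hyY hu'⟩
        refine h1.trans ?_
        have : insert y X ∩ Y = insert y (X ∩ Y) := by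
          ext v; simp only [Finset.mem_inter, Finset.mem_insert]
          constructor
          · tauto
          · rintro (rfl | h)
            · exact ⟨Or.inl rfl, hyY⟩
            · exact ⟨Or.inr h.1, h.2⟩
        rw [this]
        exact Finset.card_insert_le _ _
      have hcard : (X ∩ Y).card + 1 = r := by omega
      obtain ⟨g, hg, hgd⟩ := menger_half hGG' hcut (ih G' hlt) hA hB hXY hcard hxX hxY hyY
      obtain ⟨h, hh, hhd⟩ := menger_half (G := G) (G' := G') (x := y) (y := x) (A := B) (B := A)
        (X := Y) (Y := X) (r := r) (fun u v huv => by have := hGG' u v huv; tauto)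
        (fun X Y hX hY hs => by rw [Finset.inter_comm]; exact hcut Y X hY hX hs.symm)
        (ih G' hlt) hB hA hXY.symm (by rw [Finset.inter_comm]; exact hcard) hyY hyX hxX
      rw [Finset.inter_comm] at hh hhd
      obtain ⟨e⟩ : Nonempty (Fin r ↪ (insert x (X ∩ Y) : Finset V)) :=
        Function.Embedding.nonempty_of_card_le (by
          rw [Fintype.card_coe, Finset.card_insert_of_notMem (by simp [hxY]), hcard]; simp)
      -- The two halves are glued at the vertices of `X ∩ Y`, and the half ending at `x` is
      -- continued along the edge `xy`.
      set σ : V → V := fun t => if t = x then y else t with hσ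
      have hσmem : ∀ t ∈ insert x (X ∩ Y), σ t ∈ insert y (X ∩ Y) := by
        intro t ht
        by_cases htx : t = x
        · simp [hσ, htx]
        · have : t ∈ X ∩ Y := (Finset.mem_insert.1 ht).resolve_left htx
          simp only [hσ, htx, if_false]
          exact Finset.mem_insert_of_mem this
      have hσinj : ∀ t ∈ insert x (X ∩ Y), ∀ u ∈ insert x (X ∩ Y), t ≠ u → σ t ≠ σ u := by
        intro t ht u hu htu
        have ht' : t ≠ y := by rintro rfl; simp [hyX, hxy.ne'] at ht
        have hu' : u ≠ y := by rintro rfl; simp [hyX, hxy.ne'] at hu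
        simp only [hσ]
        split_ifs with h1 h2 h2
        · exact absurd (h1.trans h2.symm) htu
        · exact hu'.symm
        · exact ht'
        · exact htu
      set F : V → List V := fun t =>
        g t ++ t :: ((if t = x then [y] else []) ++ (h (σ t)).reverse) with hF
      have hmem : ∀ t ∈ insert x (X ∩ Y), ∀ v, v ∈ F t ↔
          v ∈ g t ∨ v = t ∨ v = σ t ∨ v ∈ h (σ t) := by
        intro t ht v
        simp only [hF, hσ]
        split_ifs with h1 <;> simp
      have hgdis : ∀ t ∈ insert x (X ∩ Y), ∀ u ∈ insert x (X ∩ Y), ∀ v ∈ g t,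
          v ≠ u ∧ v ≠ σ u ∧ v ∉ h (σ u) := by
        intro t ht u hu v hv
        have h1 := (hg t ht).2.2 v hv
        refine ⟨?_, ?_, fun h2 => ?_⟩
        · rintro rfl
          simp [h1.2.1, h1.2.2] at hu
        · rintro rfl
          have := hσmem u hu
          simp only [Finset.mem_insert, Finset.mem_inter] at this
          rcases this with h | h
          · exact h1.2.1 (h ▸ hyY)
          · exact h1.2.1 h.2
        · exact h1.2.1 ((hh _ (hσmem u hu)).2.2 v h2).1
      have hhdis : ∀ t ∈ insert x (X ∩ Y), ∀ u ∈ insert x (X ∩ Y), ∀ v ∈ h (σ t),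
          v ≠ u ∧ v ≠ σ u := by
        intro t ht u hu v hv
        have h1 := (hh _ (hσmem t ht)).2.2 v hv
        refine ⟨?_, ?_⟩
        · rintro rfl
          simp only [Finset.mem_insert, Finset.mem_inter] at hu
          rcases hu with h | h
          · exact h1.2.1 (h ▸ hxX)
          · exact h1.2.1 h.1
        · rintro rfl
          have := hσmem u hu
          simp only [Finset.mem_insert, Finset.mem_inter, h1.2.1, h1.2.2] at this
          simp at this
      have hpath : ∀ t ∈ insert x (X ∩ Y), G.PathBetween A B (F t) := by
        intro t ht
        have h1 := hg t ht
        have h2 := hh (σ t) (hσmem t ht)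
        have h3 := (h2.1.mono hlt.le).reverse
        rw [List.reverse_append, List.reverse_singleton, List.singleton_append] at h3
        have htail : G.PathList (t :: ((if t = x then [y] else []) ++ (h (σ t)).reverse)) := by
          by_cases htx : t = x
          · subst htx
            simp only [if_true]
            simp only [hσ, if_true] at h3 ⊢
            refine ⟨?_, ?_⟩
            · rw [List.singleton_append, List.isChain_cons_cons]
              exact ⟨hxy, h3.1⟩
            · rw [List.singleton_append, List.nodup_cons]
              refine ⟨?_, h3.2⟩
              simp only [List.mem_cons, List.mem_reverse, not_or]
              refine ⟨hxy.ne, fun hm => ?_⟩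
              exact ((hhdis t ht t ht t (by simpa [hσ] using hm)).1 rfl)
          · simp only [hσ, htx, if_false, List.nil_append] at h3 ⊢
            exact h3
        refine ⟨pathList_append_cons.2 ⟨h1.1.mono hlt.le, htail, ?_⟩, ?_, ?_⟩
        · intro v hv hv'
          have := hgdis t ht t ht v hv
          have hv2 : v ∈ (if t = x then [y] else []) ∨ v ∈ h (σ t) := by simpa using hv'
          rcases hv2 with hv2 | hv2
          · split_ifs at hv2 with htx
            · refine this.2.1 ?_
              simpa [hσ, htx] using hv2
            · simp at hv2
          · exact this.2.2 hv2
        · obtain ⟨a, ha, ha'⟩ := h1.2.1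
          refine ⟨a, ha, ?_⟩
          rw [hF, head?_append_cons]
          exact ha'
        · obtain ⟨b, hb, hb'⟩ := h2.2.1
          refine ⟨b, hb, ?_⟩
          have : F t = (g t ++ (if t = x then [t] else [])) ++ (h (σ t) ++ [σ t]).reverse := by
            by_cases htx : t = x <;> simp [hF, hσ, htx]
          rw [this, getLast?_append_reverse _ (by simp)]
          exact hb'
      have hdisj : ∀ t ∈ insert x (X ∩ Y), ∀ u ∈ insert x (X ∩ Y), t ≠ u →
          (F t).Disjoint (F u) := by
        intro t ht u hu htu v hv hv'
        rw [hmem t ht] at hv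
        rw [hmem u hu] at hv'
        have htu2 := hσinj t ht u hu htu
        have key : ∀ t ∈ insert x (X ∩ Y), ∀ u ∈ insert x (X ∩ Y), t ≠ u → t ≠ σ u := by
          intro t ht u hu htu
          simp only [hσ]
          split_ifs
          · rintro rfl; simp [hyX, hxy.ne'] at ht
          · exact htu
        rcases hv with hv | hv | hv | hv
        · have h1 := hgdis t ht u hu v hv
          rcases hv' with h | h | h | h
          · exact hgd t ht u hu htu hv h
          · exact h1.1 h
          · exact h1.2.1 h
          · exact h1.2.2 h
        · rcases hv' with h | h | h | h
          · exact (hgdis u hu t ht v h).1 hv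
          · exact htu (hv.symm.trans h)
          · exact key t ht u hu htu (hv.symm.trans h)
          · exact (hhdis u hu t ht v h).1 hv
        · rcases hv' with h | h | h | h
          · exact (hgdis u hu t ht v h).2.1 hv
          · exact key u hu t ht htu.symm (h.symm.trans hv)
          · exact htu2 (hv.symm.trans h)
          · exact (hhdis u hu t ht v h).2 hv
        · rcases hv' with h | h | h | h
          · exact (hgdis u hu t ht v h).2.2 hv
          · exact (hhdis t ht u hu v hv).1 h
          · exact (hhdis t ht u hu v hv).2 h
          · exact hhd _ (hσmem t ht) _ (hσmem u hu) htu2 hv h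
      exact ⟨fun i => F (e i), fun i => hpath _ (e i).2, fun i j hij =>
        hdisj _ (e i).2 _ (e j).2 fun h => hij (e.injective (Subtype.ext h))⟩

/-! ### Boundaries, elusive families and linked sets -/

open Classical in
/-- The vertices outside `W` with a neighbour in `W`. -/
noncomputable def outerBoundary [Fintype V] (G : SimpleGraph V) (W : Finset V) : Finset V :=
  {v | v ∉ W ∧ ∃ u ∈ W, G.Adj u v}

theorem mem_outerBoundary [Fintype V] {G : SimpleGraph V} {W : Finset V} {v : V} :
    v ∈ G.outerBoundary W ↔ v ∉ W ∧ ∃ u ∈ W, G.Adj u v := by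
  simp [outerBoundary]

theorem chain_subset_of_disjoint_outerBoundary [Fintype V] {G : SimpleGraph V} {l : List V}
    (hl : l.IsChain G.Adj) {W : Finset V} (hW : ∃ x ∈ l, x ∈ W)
    (hd : ∀ x ∈ l, x ∉ G.outerBoundary W) : ∀ x ∈ l, x ∈ W := by
  obtain ⟨a, ha, haW⟩ := hW
  obtain ⟨l₁, l₂, rfl⟩ := List.append_of_mem ha
  have hclosed : ∀ u ∈ (W : Set V), ∀ v ∈ {v | v ∉ G.outerBoundary W}, G.Adj u v →
      v ∈ (W : Set V) := by
    intro u hu v hv huv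
    by_contra h
    exact hv (mem_outerBoundary.2 ⟨h, u, hu, huv⟩)
  rw [List.isChain_split] at hl
  have h1 := chain_subset_of_closed hclosed hl.2 (fun x hx => hd x (by simp_all))
    (by simpa using haW)
  have h2 := chain_subset_of_closed (l := (l₁ ++ [a]).reverse) hclosed
    (by rw [List.isChain_reverse]; exact hl.1.imp fun _ _ h => h.symm)
    (fun x hx => hd x (by simp at hx ⊢; tauto)) (by simpa using haW)
  intro x hx
  rw [List.mem_append] at hx
  rcases hx with hx | hx
  · exact h2 x (by simp [hx])
  · exact h1 x hx

/-- A family of pairwise intersecting connected vertex sets such that no set of fewer than `N`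
vertices meets all of them. -/
structure IsElusive [Fintype V] (G : SimpleGraph V) (F : Set (Finset V)) (N : ℕ) : Prop where
  inter : ∀ A ∈ F, ∀ B ∈ F, ∃ x ∈ A, x ∈ B
  conn : ∀ A ∈ F, ∀ W, (∃ x ∈ A, x ∈ W) → (∀ x ∈ A, x ∉ G.outerBoundary W) → A ⊆ W
  avoid : ∀ T : Finset V, T.card < N → ∃ A ∈ F, ∀ x ∈ A, x ∉ T

/-- `A` cannot be separated by fewer than `r` vertices from the members of `F`. -/
def Linked [Fintype V] (G : SimpleGraph V) (F : Set (Finset V)) (A : Finset V) (r : ℕ) : Prop :=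
  ∀ W : Finset V, (∃ B ∈ F, B ⊆ W) → (G.outerBoundary W).card < r → ∃ x ∈ A, x ∈ W

section

variable [Fintype V] {G : SimpleGraph V} {F : Set (Finset V)} {N : ℕ}

theorem IsElusive.linked_of_mem (h : G.IsElusive F N) {A : Finset V} (hA : A ∈ F) (r : ℕ) :
    G.Linked F A r := by
  rintro W ⟨B, hB, hBW⟩ -
  obtain ⟨x, hx, hxB⟩ := h.inter A hA B hB
  exact ⟨x, hx, hBW hxB⟩

/-- A member of the family avoiding the boundary of a set containing another member lies in
that set. -/
theorem IsElusive.subset_of_avoid (h : G.IsElusive F N) {A W : Finset V} (hA : A ∈ F)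
    (hW : ∃ B ∈ F, B ⊆ W) (hd : ∀ x ∈ A, x ∉ G.outerBoundary W) : A ⊆ W := by
  obtain ⟨B, hB, hBW⟩ := hW
  obtain ⟨x, hx, hxB⟩ := h.inter A hA B hB
  exact h.conn A hA W ⟨x, hx, hBW hxB⟩ hd

open Classical in
theorem outerBoundary_compl_subset (D : Finset V) : G.outerBoundary Dᶜ ⊆ D := fun v hv => by
  have := (mem_outerBoundary.1 hv).1
  simpa using this

open Classical in
-- If `D` had fewer than `r` vertices, some member would avoid it. The complement of `D` then
-- contains a member and has its boundary inside `D`, yet `D` does not meet it.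
theorem Linked.le_card (h : G.IsElusive F N) {D : Finset V} {r : ℕ} (hD : G.Linked F D r)
    (hr : r ≤ N) : r ≤ D.card := by
  by_contra! hlt
  obtain ⟨A, hA, hAD⟩ := h.avoid D (hlt.trans_le hr)
  obtain ⟨x, hx, hx'⟩ := hD Dᶜ ⟨A, hA, fun x hx => by simpa using hAD x hx⟩
    ((Finset.card_le_card (outerBoundary_compl_subset D)).trans_lt hlt)
  simp [hx] at hx'

open Classical in
/-- If a member of `F` is covered by few sets, one of which is small, then another one is
linked. -/
theorem IsElusive.exists_linked_of_cover (h : G.IsElusive F N) {ι : Type*} {s : Finset ι}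
    {I : ι → Finset V} {r : ℕ} {A : Finset V} (hA : A ∈ F) (E : Finset V)
    (hcov : ∀ x ∈ A, x ∈ E ∨ ∃ i ∈ s, x ∈ I i) (hcard : E.card + s.card * r < N) :
    ∃ i ∈ s, G.Linked F (I i) (r + 1) := by
  by_contra! hno
  have hno' : ∀ i ∈ s, ∃ W : Finset V, (∃ B ∈ F, B ⊆ W) ∧ (G.outerBoundary W).card ≤ r ∧
      ∀ x ∈ I i, x ∉ W := by
    intro i hi
    have := hno i hi
    unfold Linked at this
    push Not at this
    obtain ⟨W, h1, h2, h3⟩ := this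
    exact ⟨W, h1, by omega, h3⟩
  choose! W hW hWc hWI using hno'
  -- A member avoiding `E` and all the boundaries lies in every `W i`, hence misses `E` and every `I
  -- i`. This contradicts its meeting `A`.
  obtain ⟨B, hB, hBT⟩ := h.avoid (E ∪ s.biUnion fun i => G.outerBoundary (W i)) (by
    refine (Finset.card_union_le _ _).trans_lt (lt_of_le_of_lt ?_ hcard)
    have := Finset.card_biUnion_le_card_mul s (fun i => G.outerBoundary (W i)) r hWc
    omega)
  obtain ⟨x, hx, hxB⟩ := h.inter A hA B hB
  have hx' := hBT x hxB
  simp only [Finset.mem_union, Finset.mem_biUnion, not_or, not_exists, not_and] at hx'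
  rcases hcov x hx with hE | ⟨i, hi, hxi⟩
  · exact hx'.1 hE
  · have hBW := h.subset_of_avoid hB (hW i hi) fun y hy => by
      have := hBT y hy
      simp only [Finset.mem_union, Finset.mem_biUnion, not_or, not_exists, not_and] at this
      exact this.2 i hi
    exact hWI i hi x hxi (hBW hxB)

open Classical in
-- Submodularity of the boundary size, used below for uncrossing.
theorem card_outerBoundary_inter_add_union (W W' : Finset V) :
    (G.outerBoundary (W ∩ W')).card + (G.outerBoundary (W ∪ W')).card ≤
      (G.outerBoundary W).card + (G.outerBoundary W').card := by
  rw [← Finset.card_union_add_card_inter (G.outerBoundary (W ∩ W')),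
    ← Finset.card_union_add_card_inter (G.outerBoundary W)]
  refine Nat.add_le_add (Finset.card_le_card fun v hv => ?_) (Finset.card_le_card fun v hv => ?_)
  · simp only [Finset.mem_union, mem_outerBoundary, Finset.mem_inter] at hv ⊢
    rcases hv with ⟨hv, u, ⟨hu, hu'⟩, huv⟩ | ⟨hv, u, hu, huv⟩
    · by_cases h : v ∈ W
      · exact Or.inr ⟨fun h' => hv ⟨h, h'⟩, u, hu', huv⟩
      · exact Or.inl ⟨h, u, hu, huv⟩
    · rcases hu with hu | hu
      · exact Or.inl ⟨fun h => hv (Or.inl h), u, hu, huv⟩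
      · exact Or.inr ⟨fun h => hv (Or.inr h), u, hu, huv⟩
  · simp only [Finset.mem_union, mem_outerBoundary, Finset.mem_inter, not_or] at hv ⊢
    obtain ⟨⟨-, u, ⟨hu, hu'⟩, huv⟩, ⟨h1, h2⟩, -⟩ := hv
    exact ⟨⟨h1, u, hu, huv⟩, h2, u, hu', huv⟩

open Classical in
theorem IsElusive.exists_subset_inter (h : G.IsElusive F N) {W W' : Finset V}
    (hW : ∃ B ∈ F, B ⊆ W) (hW' : ∃ B ∈ F, B ⊆ W')
    (hc : (G.outerBoundary W).card + (G.outerBoundary W').card < N) :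
    ∃ B ∈ F, B ⊆ W ∩ W' := by
  obtain ⟨A, hA, hAd⟩ := h.avoid (G.outerBoundary W ∪ G.outerBoundary W')
    ((Finset.card_union_le _ _).trans_lt hc)
  refine ⟨A, hA, Finset.subset_inter (h.subset_of_avoid hA hW fun x hx hx' => ?_)
    (h.subset_of_avoid hA hW' fun x hx hx' => ?_)⟩ <;>
  exact hAd x hx (by simp [hx'])

open Classical in
/-- A linked set contains a linked set of the smallest possible size. -/
theorem IsElusive.exists_linked_subset_card_eq (h : G.IsElusive F N) {Y : Finset V} {r : ℕ}
    (hY : G.Linked F Y r) (hr : 2 * r ≤ N) : ∃ D ⊆ Y, D.card = r ∧ G.Linked F D r := by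
  obtain ⟨D, hDY, hD⟩ := exists_minimal_le_of_wellFoundedLT (fun D => G.Linked F D r) Y hY
  have hDr := Linked.le_card h hD.1 (by omega)
  refine ⟨D, hDY, le_antisymm ?_ hDr, hD.1⟩
  -- By minimality, each `d` has a witness `W` that `D` meets at most in `d`. Uniting the witnesses
  -- one at a time lowers the boundary by one each time (`key`), so there are at most `r` of them.
  have hone : ∀ d ∈ D, ∃ W : Finset V, (∃ B ∈ F, B ⊆ W) ∧ (G.outerBoundary W).card + 1 ≤ r ∧
      ∀ x ∈ D, x ≠ d → x ∉ W := by
    intro d hd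
    have hno : ¬ G.Linked F (D.erase d) r := fun h' => by
      have := hD.2 h' (Finset.erase_subset d D) hd
      simp at this
    unfold Linked at hno
    push Not at hno
    obtain ⟨W, h1, h2, h3⟩ := hno
    exact ⟨W, h1, h2, fun x hx hxd => h3 x (Finset.mem_erase.2 ⟨hxd, hx⟩)⟩
  have key : ∀ E : Finset V, E ⊆ D → E.Nonempty → ∃ W : Finset V, (∃ B ∈ F, B ⊆ W) ∧
      (G.outerBoundary W).card + E.card ≤ r ∧ ∀ x ∈ D, x ∉ E → x ∉ W := by
    intro E
    induction E using Finset.induction_on with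
    | empty => simp
    | insert d E hd ih =>
      intro hE _
      obtain ⟨W, hW, hWc, hWD⟩ := hone d (hE (Finset.mem_insert_self d E))
      rcases E.eq_empty_or_nonempty with rfl | hne
      · exact ⟨W, hW, by simpa using hWc, fun x hx hxd => hWD x hx (by simpa using hxd)⟩
      · obtain ⟨U, hU, hUc, hUD⟩ := ih ((Finset.subset_insert d E).trans hE) hne
        have hbig := h.exists_subset_inter hW hU (by omega)
        -- The intersection contains a member but misses `D`, so linkedness of `D` makes its
        -- boundary large. Submodularity then makes the boundary of the union small.
        have hge : r ≤ (G.outerBoundary (W ∩ U)).card := by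
          by_contra! hlt
          obtain ⟨x, hx, hxW⟩ := hD.1 _ hbig hlt
          rw [Finset.mem_inter] at hxW
          by_cases hxd : x = d
          · subst hxd
            exact hUD x hx hd hxW.2
          · exact hWD x hx hxd hxW.1
        have hsub := card_outerBoundary_inter_add_union (G := G) W U
        obtain ⟨B, hB, hBW⟩ := hW
        refine ⟨W ∪ U, ⟨B, hB, hBW.trans Finset.subset_union_left⟩, ?_, fun x hx hxE => ?_⟩
        · rw [Finset.card_insert_of_notMem hd]
          omega
        · rw [Finset.mem_insert, not_or] at hxE
          rw [Finset.mem_union, not_or]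
          exact ⟨hWD x hx hxE.1, hUD x hx hxE.2⟩
  rcases D.eq_empty_or_nonempty with hD0 | hne
  · simp [hD0]
  · obtain ⟨W, -, hW, -⟩ := key D le_rfl hne
    omega

open Classical in
-- Here `D` is independent, that is, linked to the order of its own size. Otherwise the boundary of
-- `W` together with `D ∩ W` would have fewer than `D.card` vertices and would cut `D` off from a
-- member inside `W \ D`.
theorem IsElusive.card_sdiff_le (h : G.IsElusive F N) {D W : Finset V}
    (hD : G.Linked F D D.card) (hN : D.card ≤ N) (hW : ∃ B ∈ F, B ⊆ W) :
    (D \ W).card ≤ (G.outerBoundary W).card := by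
  by_contra! hlt
  have hsub : G.outerBoundary (W \ D) ⊆ G.outerBoundary W ∪ (D ∩ W) := by
    intro v hv
    simp only [Finset.mem_union, mem_outerBoundary, Finset.mem_inter, Finset.mem_sdiff] at hv ⊢
    obtain ⟨h1, u, hu, huv⟩ := hv
    by_cases hvW : v ∈ W
    · right; tauto
    · exact Or.inl ⟨hvW, u, hu.1, huv⟩
  have hcard : (G.outerBoundary W ∪ (D ∩ W)).card < D.card := by
    have h1 := Finset.card_union_le (G.outerBoundary W) (D ∩ W)
    have h2 := Finset.card_sdiff_add_card_inter D W
    omega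
  obtain ⟨A, hA, hAT⟩ := h.avoid _ (hcard.trans_le hN)
  have hAW := h.subset_of_avoid hA hW fun x hx hx' => hAT x hx (by simp [hx'])
  obtain ⟨x, hx, hx'⟩ := hD (W \ D) ⟨A, hA, fun x hx => by
    have := hAT x hx
    have := hAW hx
    simp_all⟩ ((Finset.card_le_card hsub).trans_lt hcard)
  simp [hx] at hx'

open Classical in
-- By Menger. A member avoiding the separator of a small separation lies strictly on one side, which
-- then cannot be cut off from `A` or `B`, although one of the two sets misses that side.
theorem IsElusive.exists_disjoint_paths (h : G.IsElusive F N) {A B : Finset V} {r : ℕ}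
    (hA : G.Linked F A r) (hB : G.Linked F B r) (hr : r ≤ N) :
    ∃ f : Fin r → List V, (∀ i, G.PathBetween A B (f i)) ∧
      Pairwise fun i j => (f i).Disjoint (f j) := by
  refine G.menger A B r fun X Y hAX hBY hXY => ?_
  by_contra! hlt
  obtain ⟨C, hC, hCT⟩ := h.avoid _ (hlt.trans_le hr)
  have key : ∀ X Y : Finset V, G.IsSeparation X Y → G.outerBoundary (X \ Y) ⊆ X ∩ Y := by
    intro X Y hXY v hv
    obtain ⟨h1, u, hu, huv⟩ := mem_outerBoundary.1 hv
    rw [Finset.mem_sdiff] at hu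
    have := hXY.2 u v huv hu.1 hu.2
    simp only [Finset.mem_sdiff, not_and, not_not] at h1
    simp [this, h1 this]
  have hk1 := key X Y hXY
  have hk2 := key Y X hXY.symm
  obtain ⟨x, hx, -⟩ := h.inter C hC C hC
  have hxT := hCT x hx
  by_cases hxX : x ∈ X
  · have hCX : C ⊆ X \ Y := h.conn C hC _ ⟨x, hx, by simp_all⟩ fun y hy hy' => hCT y hy (hk1 hy')
    obtain ⟨b, hb, hb'⟩ := hB (X \ Y) ⟨C, hC, hCX⟩ ((Finset.card_le_card hk1).trans_lt hlt)
    exact (Finset.mem_sdiff.1 hb').2 (hBY hb)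
  · have hxY := (hXY.1 x).resolve_left hxX
    have hCX : C ⊆ Y \ X := h.conn C hC _ ⟨x, hx, by simp_all⟩ fun y hy hy' => hCT y hy (by
      rw [Finset.inter_comm]; exact hk2 hy')
    obtain ⟨b, hb, hb'⟩ := hA (Y \ X) ⟨C, hC, hCX⟩ ((Finset.card_le_card hk2).trans_lt (by
      rwa [Finset.inter_comm]))
    exact (Finset.mem_sdiff.1 hb').2 (hAX hb)

end

/-! ### Cycles, detours and close pairs on a path -/

/-- The vertex sequence of a cycle; a single edge is allowed. -/
def CycleList (G : SimpleGraph V) (l : List V) : Prop :=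
  G.PathList l ∧ ∀ a ∈ l.head?, ∀ b ∈ l.getLast?, G.Adj b a

theorem CycleList.rotate {G : SimpleGraph V} {l m : List V} (h : G.CycleList (l ++ m)) :
    G.CycleList (m ++ l) := by
  rcases l.eq_nil_or_concat with rfl | ⟨l, b, rfl⟩
  · simpa using h
  rcases m with _ | ⟨a, m⟩
  · simpa using h
  obtain ⟨⟨h1, h2⟩, h3⟩ := h
  rw [List.isChain_append] at h1
  refine ⟨⟨?_, (List.perm_append_comm.nodup_iff).1 h2⟩, ?_⟩
  · rw [List.isChain_append]
    refine ⟨h1.2.1, h1.1, fun x hx y hy => h3 y ?_ x ?_⟩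
    · rw [Option.mem_def] at hy ⊢
      rw [List.head?_append, hy]; rfl
    · rw [Option.mem_def] at hx ⊢
      rw [List.getLast?_append, hx]; rfl
  · intro x hx y hy
    have he : a :: m ++ l.concat b = (a :: m ++ l) ++ [b] := by simp
    rw [he, List.getLast?_concat] at hy
    refine h1.2.2 y ?_ x ?_
    · rw [List.concat_eq_append, List.getLast?_concat]; exact hy
    · simpa using hx

/-- The longer of the two arcs between `a` and `b`: together they have `O.length - 2` inner
vertices. -/
theorem CycleList.exists_arc {G : SimpleGraph V} {O : List V} (hO : G.CycleList O) {a b : V}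
    (ha : a ∈ O) (hb : b ∈ O) (hab : a ≠ b) :
    ∃ d, G.PathList (a :: d ++ [b]) ∧ (∀ x ∈ d, x ∈ O) ∧ O.length ≤ 2 * (d.length + 1) := by
  obtain ⟨l, m, rfl⟩ := List.append_of_mem ha
  have h1 := hO.rotate
  have hb' : b ∈ m ++ l := by simp at hb ⊢; tauto
  obtain ⟨A, B, hAB⟩ := List.append_of_mem hb'
  have hmem : ∀ x, x ∈ A ∨ x ∈ B → x ∈ l ++ a :: m := by
    intro x hx
    have : x ∈ m ++ l := by rw [hAB]; simp; tauto
    simp at this ⊢; tauto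
  have hlen : (l ++ a :: m).length = A.length + B.length + 2 := by
    have := congrArg List.length hAB
    simp at this ⊢; omega
  rw [List.cons_append, hAB, ← List.cons_append] at h1
  by_cases hle : B.length ≤ A.length
  · exact ⟨A, h1.1.infix ⟨[], B, by simp⟩, fun x hx => hmem x (Or.inl hx), by omega⟩
  · refine ⟨B.reverse, ?_, fun x hx => hmem x (Or.inr (by simpa using hx)), by
      rw [List.length_reverse]; omega⟩
    have := (h1.rotate.1.infix (m := b :: B ++ [a]) ⟨[], A, by simp⟩).reverse
    simpa using this

/-- No detour off `l` between two vertices of `l` is longer than the stretch of `l` that it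
bypasses. -/
def Taut (G : SimpleGraph V) (l : List V) : Prop :=
  ∀ l₁ a m b l₃ d, l = l₁ ++ a :: m ++ b :: l₃ → G.PathList (a :: d ++ [b]) →
    (∀ x ∈ d, x ∉ l) → d.length ≤ m.length

theorem exists_split_of_idxOf_lt [DecidableEq V] {l : List V} {a b : V}
    (hb : b ∈ l) (h : l.idxOf a < l.idxOf b) :
    ∃ l₁ m l₃, l = l₁ ++ a :: m ++ b :: l₃ ∧ l.idxOf b = l.idxOf a + m.length + 1 ∧
      l₁.length = l.idxOf a := by
  have hbl := List.idxOf_lt_length_of_mem hb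
  have ha' : l[l.idxOf a]'(h.trans hbl) = a := List.getElem_idxOf _
  have hb' : l[l.idxOf b] = b := List.getElem_idxOf _
  refine ⟨l.take (l.idxOf a), (l.drop (l.idxOf a + 1)).take (l.idxOf b - l.idxOf a - 1),
    l.drop (l.idxOf b + 1), ?_, ?_, ?_⟩
  · conv_lhs => rw [← List.take_append_drop (l.idxOf a) l,
      List.drop_eq_getElem_cons (h.trans hbl), ha',
      ← List.take_append_drop (l.idxOf b - l.idxOf a - 1) (l.drop (l.idxOf a + 1))]
    rw [List.drop_drop, show l.idxOf a + 1 + (l.idxOf b - l.idxOf a - 1) = l.idxOf b by omega,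
      List.drop_eq_getElem_cons hbl, hb']
    simp
  · rw [List.length_take, List.length_drop]; omega
  · rw [List.length_take]; omega

theorem exists_path_within [DecidableEq V] {G : SimpleGraph V} {l : List V} (hl : G.PathList l)
    {a b : V} (ha : a ∈ l) (hb : b ∈ l) (hab : a ≠ b) :
    ∃ d, G.PathList (a :: d ++ [b]) ∧ (∀ x ∈ d, x ∈ l) ∧ d.length + 2 ≤ l.length := by
  rcases lt_trichotomy (l.idxOf a) (l.idxOf b) with h | h | h
  · obtain ⟨l₁, m, l₃, h1, -, -⟩ := exists_split_of_idxOf_lt hb h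
    refine ⟨m, hl.infix ⟨l₁, l₃, by simp [h1]⟩, fun x hx => by simp [h1, hx], ?_⟩
    rw [h1]; simp; omega
  · exact absurd ((List.idxOf_inj ha).1 h) hab
  · obtain ⟨l₁, m, l₃, h1, -, -⟩ := exists_split_of_idxOf_lt ha h
    refine ⟨m.reverse, ?_, fun x hx => by
      rw [List.mem_reverse] at hx
      simp [h1, hx], ?_⟩
    · have := (hl.infix (m := b :: m ++ [a]) ⟨l₁, l₃, by simp [h1]⟩).reverse
      simpa using this
    · rw [h1]; simp; omega

/-- Pigeonhole: split the positions into `w` blocks of `w`, so that two of the `w + 1` vertices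
share a block. -/
theorem exists_close_pair [DecidableEq V] {l : List V} {w : ℕ}
    (hlen : l.length ≤ w * w) {s : Fin (w + 1) → V} (hs : ∀ i, s i ∈ l)
    (hinj : Function.Injective s) :
    ∃ i j l₁ m l₃, i ≠ j ∧ l = l₁ ++ s i :: m ++ s j :: l₃ ∧ m.length < w := by
  have hlt : ∀ i, l.idxOf (s i) < w * w := fun i =>
    (List.idxOf_lt_length_of_mem (hs i)).trans_le hlen
  have hw : 0 < w := by
    by_contra h
    have := hlt 0
    simp_all
  obtain ⟨i, j, hij, he⟩ := Fintype.exists_ne_map_eq_of_card_lt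
    (fun i : Fin (w + 1) => (⟨l.idxOf (s i) / w, Nat.div_lt_of_lt_mul (hlt i)⟩ : Fin w))
    (by simp)
  have he' : l.idxOf (s i) / w = l.idxOf (s j) / w := by simpa using he
  have h1 := Nat.div_add_mod (l.idxOf (s i)) w
  have h2 := Nat.div_add_mod (l.idxOf (s j)) w
  have h3 := Nat.mod_lt (l.idxOf (s i)) hw
  have h4 := Nat.mod_lt (l.idxOf (s j)) hw
  rw [he'] at h1
  rcases lt_trichotomy (l.idxOf (s i)) (l.idxOf (s j)) with h | h | h
  · obtain ⟨l₁, m, l₃, h5, h6, -⟩ := exists_split_of_idxOf_lt (hs j) h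
    exact ⟨i, j, l₁, m, l₃, hij, h5, by omega⟩
  · exact absurd (hinj ((List.idxOf_inj (hs i)).1 h)) hij
  · obtain ⟨l₁, m, l₃, h5, h6, -⟩ := exists_split_of_idxOf_lt (hs i) h
    exact ⟨j, i, l₁, m, l₃, hij.symm, h5, by omega⟩

/-- A path from `A` to `B` contains a path from `A` to `B` whose inner vertices avoid
`A` and `B`. -/
theorem PathBetween.exists_clean {G : SimpleGraph V} {A B : Finset V} {l : List V}
    (h : G.PathBetween A B l) (hAB : ∀ x ∈ A, x ∉ B) :
    ∃ u a m b t, l = u ++ a :: (m ++ b :: t) ∧ a ∈ A ∧ b ∈ B ∧ (∀ x ∈ m, x ∉ A ∧ x ∉ B) ∧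
      G.PathList (a :: m ++ [b]) := by
  obtain ⟨hl, ⟨a₀, ha₀, ha₀'⟩, b₀, hb₀, hb₀'⟩ := h
  obtain ⟨u, a, v, rfl, ha, hv⟩ := exists_last_split (A : Set V) (l := l)
    ⟨a₀, List.mem_of_mem_head? ha₀', ha₀⟩
  have hb₀v : b₀ ∈ v := by
    rcases v.eq_nil_or_concat with rfl | ⟨v, c, rfl⟩
    · simp at hb₀'
      exact absurd hb₀ (hb₀' ▸ hAB a ha)
    · have he : u ++ a :: v.concat c = (u ++ a :: v) ++ [c] := by simp
      rw [he, List.getLast?_concat, Option.mem_def, Option.some_inj] at hb₀'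
      simp [hb₀']
  obtain ⟨m, b, t, rfl, hb, hm⟩ := exists_first_split (B : Set V) (l := v) ⟨b₀, hb₀v, hb₀⟩
  exact ⟨u, a, m, b, t, rfl, ha, hb, fun x hx => ⟨hv x (by simp [hx]), hm x hx⟩,
    hl.infix ⟨u, t, by simp⟩⟩

/-! ### A short linked cycle is impossible -/

section

variable [Fintype V] {G : SimpleGraph V} {F : Set (Finset V)} {N w : ℕ}

open Classical in
-- A member `S` avoiding `O` is joined to `O` by `w + 1` disjoint paths. Two of them end close
-- together on `S`, and the longer arc of `O` between them makes a detour that is too long for a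
-- taut list.
theorem IsElusive.false_of_cycle (h : G.IsElusive F N)
    (hF : ∀ A ∈ F, ∃ l, G.PathList l ∧ l.toFinset = A ∧ G.Taut l) {O : List V}
    (hO : G.CycleList O) (hON : O.length < N) (hOw : 2 * w ≤ O.length)
    (hOl : G.Linked F O.toFinset (w + 1)) (hw : w + 1 ≤ N)
    (hn : Fintype.card V ≤ w * w) : False := by
  obtain ⟨A, hA, hAO⟩ := h.avoid O.toFinset ((List.toFinset_card_le O).trans_lt hON)
  obtain ⟨S, hS, rfl, hST⟩ := hF A hA
  obtain ⟨f, hf, hd⟩ := h.exists_disjoint_paths hOl (h.linked_of_mem hA (w + 1)) hw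
  have hclean := fun i => (hf i).exists_clean fun x hx hx' => hAO x hx' hx
  choose u o m s t hfe ho hs hm hp using hclean
  have hmemf : ∀ i x, x = o i ∨ x ∈ m i ∨ x = s i → x ∈ f i := by
    intro i x hx; rw [hfe]; simp; tauto
  have hdis : ∀ i j x, i ≠ j → x ∈ f i → x ∉ f j := fun i j x hij hx hx' => hd hij hx hx'
  have hSlen : S.length ≤ w * w := by
    refine le_trans ?_ hn
    rw [← List.toFinset_card_of_nodup hS.2]
    exact Finset.card_le_univ _
  obtain ⟨i, j, l₁, ms, l₃, hij, hSe, hms⟩ := exists_close_pair hSlen (s := s)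
    (fun i => by simpa using hs i) (fun i j hij => by
      by_contra hne
      exact hdis i j (s i) hne (hmemf i _ (by simp)) (hmemf j _ (by simp [hij])))
  have hoij : o i ≠ o j := fun he =>
    hdis i j (o i) hij (hmemf i _ (by simp)) (hmemf j _ (by simp [he]))
  obtain ⟨d, hdp, hdO, hdl⟩ := hO.exists_arc (by simpa using ho i) (by simpa using ho j) hoij
  have hOS : ∀ x, x ∈ O → x ∉ S := fun x hx hx' => hAO x (by simpa using hx') (by simpa using hx)
  have hmO : ∀ k, ∀ x ∈ m k, x ∉ O ∧ x ∉ S := fun k x hx => by simpa using hm k x hx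
  have hsS : ∀ k, s k ∈ S := fun k => by simpa using hs k
  have hoO : ∀ k, o k ∈ O := fun k => by simpa using ho k
  have hpath : G.PathList (s i :: ((m i).reverse ++ o i :: (d ++ o j :: m j)) ++ [s j]) := by
    have h1 : G.PathList (s i :: (m i).reverse ++ [o i]) := by simpa using (hp i).reverse
    have h2 : G.PathList (o i :: d ++ o j :: (m j ++ [s j])) := by
      refine pathList_append_cons.2 ⟨hdp, hp j, ?_⟩
      intro x hx hx'
      have hxO : x ∈ O := by
        rcases List.mem_cons.1 hx with rfl | hx
        · exact hoO i
        · exact hdO x hx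
      rcases List.mem_append.1 hx' with hx' | hx'
      · exact (hmO j x hx').1 hxO
      · rw [List.mem_singleton] at hx'
        exact hOS x hxO (hx' ▸ hsS j)
    have := pathList_append_cons (G := G) (l := s i :: (m i).reverse) (a := o i)
      (m := d ++ o j :: (m j ++ [s j]))
    simp only [List.cons_append, List.append_assoc] at this h1 h2 ⊢
    refine this.2 ⟨h1, h2, ?_⟩
    intro x hx hx'
    simp only [List.mem_cons, List.mem_reverse, List.mem_append, List.not_mem_nil,
      or_false] at hx hx'
    have hxi : x ∈ f i := hmemf i x (by tauto)
    rcases hx' with hx' | rfl | hx' | rfl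
    · rcases hx with rfl | hx
      · exact hOS _ (hdO _ hx') (hsS i)
      · exact (hmO i x hx).1 (hdO _ hx')
    · exact hdis i j _ hij hxi (hmemf j _ (by simp))
    · exact hdis i j _ hij hxi (hmemf j _ (by simp [hx']))
    · exact hdis i j _ hij hxi (hmemf j _ (by simp))
  have := hST l₁ (s i) ms (s j) l₃ _ hSe hpath (by
    intro x hx
    simp only [List.mem_cons, List.mem_reverse, List.mem_append] at hx
    rcases hx with hx | rfl | hx | rfl | hx
    · exact (hmO i x hx).2
    · exact hOS _ (hoO i)
    · exact hOS _ (hdO _ hx)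
    · exact hOS _ (hoO j)
    · exact (hmO j x hx).2)
  -- The arc has at least `w - 1` inner vertices and two ends, so the detour has more than `w`,
  -- against fewer than `w` bypassed.
  simp only [List.length_append, List.length_reverse, List.length_cons] at this
  omega

end

/-! ### Construction of a short linked cycle -/

theorem mem_between_of_idxOf_le [DecidableEq V] {l l₁ m l₃ : List V} {a b c : V}
    (hl : l = l₁ ++ a :: m ++ b :: l₃) (hn : l.Nodup) (hc : c ∈ l)
    (hac : l.idxOf a ≤ l.idxOf c) (hcb : l.idxOf c ≤ l.idxOf b) : c ∈ a :: m ++ [b] := by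
  subst hl
  by_contra hcon
  have hc' : c ∈ l₁ ∨ c ∈ l₃ := by simp at hc hcon; tauto
  have ha : (l₁ ++ a :: m ++ b :: l₃).idxOf a = l₁.length := by
    have : a ∉ l₁ := by grind [List.nodup_append]
    simp [List.idxOf_append_of_notMem this]
  have hb : (l₁ ++ a :: m ++ b :: l₃).idxOf b = (l₁ ++ a :: m).length := by
    have : b ∉ l₁ ++ a :: m := by grind [List.nodup_append]
    rw [List.idxOf_append_of_notMem this, List.idxOf_cons_self, Nat.add_zero]
  rcases hc' with h | h
  · have : (l₁ ++ a :: m ++ b :: l₃).idxOf c = l₁.idxOf c := by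
      rw [List.append_assoc, List.idxOf_append_of_mem h]
    have := List.idxOf_lt_length_of_mem h
    omega
  · have h1 : c ∉ l₁ ++ a :: m := by grind [List.nodup_append]
    have h2 : c ≠ b := by rintro rfl; simp at hcon
    have : (l₁ ++ a :: m ++ b :: l₃).idxOf c = (l₁ ++ a :: m).length + (l₃.idxOf c + 1) := by
      rw [List.idxOf_append_of_notMem h1, List.idxOf_cons_ne _ h2.symm]
    omega

/-- Closes up an arc in `X` and an arc in `Y` by two disjoint paths between them. It serves both for
the linked cycle and for merging two disjoint longest cycles. -/
theorem cycleList_glue {G : SimpleGraph V} {X Y : Set V} (hXY : ∀ x ∈ X, x ∉ Y)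
    {a a' b b' : V} {d e m m' : List V} (hd : G.PathList (a :: d ++ [a']))
    (he : G.PathList (b' :: e ++ [b])) (hm : G.PathList (a :: m ++ [b]))
    (hm' : G.PathList (a' :: m' ++ [b'])) (hdX : ∀ x ∈ a :: d ++ [a'], x ∈ X)
    (heY : ∀ x ∈ b' :: e ++ [b], x ∈ Y) (hmX : ∀ x ∈ m, x ∉ X ∧ x ∉ Y)
    (hmX' : ∀ x ∈ m', x ∉ X ∧ x ∉ Y) (hmm : (a :: m ++ [b]).Disjoint (a' :: m' ++ [b'])) :
    G.CycleList (a :: d ++ a' :: (m' ++ b' :: (e ++ b :: m.reverse))) := by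
  have hrev : G.PathList (b :: m.reverse ++ [a]) := by simpa using hm.reverse
  have hX : ∀ x, x = a ∨ x ∈ d ∨ x = a' → x ∈ X := fun x hx => hdX x (by simp; tauto)
  have hY : ∀ x, x = b' ∨ x ∈ e ∨ x = b → x ∈ Y := fun x hx => heY x (by simp; tauto)
  have hdis : ∀ x, x = a ∨ x ∈ m ∨ x = b → ¬ (x = a' ∨ x ∈ m' ∨ x = b') := fun x hx hx' =>
    hmm (a := x) (by simp; tauto) (by simp; tauto)
  have h1 : G.PathList (b' :: e ++ b :: m.reverse) := by
    refine pathList_append_cons.2 ⟨he, hrev.infix ⟨[], [a], by simp⟩, fun x hx hx' => ?_⟩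
    exact (hmX x (by simpa using hx')).2 (hY x (by simp at hx; tauto))
  have h2 : G.PathList (a' :: m' ++ b' :: (e ++ b :: m.reverse)) := by
    refine pathList_append_cons.2 ⟨hm', by simpa using h1, fun x hx hx' => ?_⟩
    simp only [List.mem_cons, List.mem_append, List.mem_reverse] at hx hx'
    rcases hx' with hx' | hx'
    · rcases hx with rfl | hx
      · exact hXY _ (hX x (by tauto)) (hY x (by tauto))
      · exact (hmX' x hx).2 (hY x (by tauto))
    · exact hdis x (by tauto) (by tauto)
  refine ⟨pathList_append_cons.2 ⟨hd, by simpa using h2, fun x hx hx' => ?_⟩, ?_⟩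
  · have hxX : x ∈ X := hX x (by simp at hx; tauto)
    simp only [List.mem_cons, List.mem_append, List.mem_reverse] at hx'
    rcases hx' with hx' | rfl | hx' | rfl | hx'
    · exact (hmX' x hx').1 hxX
    · exact hXY _ hxX (hY _ (by simp))
    · exact hXY _ hxX (hY x (by tauto))
    · exact hXY _ hxX (hY _ (by simp))
    · exact (hmX x hx').1 hxX
  · intro c hc f hf
    have hc' : c = a := by simpa using hc.symm
    have hO' : a :: d ++ a' :: (m' ++ b' :: (e ++ b :: m.reverse)) =
        (a :: d ++ a' :: (m' ++ b' :: e)) ++ b :: m.reverse := by simp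
    rw [hO', List.getLast?_append_of_ne_nil _ (by simp)] at hf
    rw [hc']
    exact (List.isChain_append.1 hrev.1).2.2 f hf a (by simp)

theorem exists_short_of_disjoint [Fintype V] {w : ℕ} (hw : Fintype.card V < w * w)
    (m : Fin w → List V) (hn : ∀ i, (m i).Nodup)
    (hd : ∀ i j, i ≠ j → (m i).Disjoint (m j)) : ∃ i, (m i).length < w := by
  classical
  by_contra! h
  have h1 : (Finset.univ.biUnion fun i => (m i).toFinset).card = ∑ i, (m i).toFinset.card :=
    Finset.card_biUnion fun i _ j _ hij => by
      refine Finset.disjoint_left.2 fun x hx hx' => ?_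
      exact hd i j hij (by simpa using hx) (by simpa using hx')
  have h2 : w * w ≤ ∑ i, (m i).toFinset.card := by
    have : ∑ _i : Fin w, w ≤ ∑ i, (m i).toFinset.card :=
      Finset.sum_le_sum fun i _ => by rw [List.toFinset_card_of_nodup (hn i)]; exact h i
    simpa using this
  have h3 := Finset.card_le_univ (Finset.univ.biUnion fun i => (m i).toFinset)
  omega

section

variable [Fintype V] {G : SimpleGraph V} {F : Set (Finset V)} {N w : ℕ}

open Classical in
/-- If more than twice as many disjoint paths start in `O` as a boundary has vertices, and they
end in an independent set `D`, then `O` is linked. -/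
theorem IsElusive.linked_of_disjoint_paths (h : G.IsElusive F N) {D O : Finset V}
    (hD : G.Linked F D D.card) (hN : D.card ≤ N) {ι : Type*} {K : Finset ι} {f : ι → List V}
    (hf : ∀ i ∈ K, (f i).IsChain G.Adj) (hfO : ∀ i ∈ K, ∃ x ∈ f i, x ∈ O)
    (hfD : ∀ i ∈ K, ∃ x ∈ f i, x ∈ D)
    (hd : ∀ i ∈ K, ∀ j ∈ K, i ≠ j → (f i).Disjoint (f j)) (hK : 2 * w < K.card) :
    G.Linked F O (w + 1) := by
  intro W hW hWc
  by_contra! hO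
  have hle := h.card_sdiff_le hD hN hW
  -- A path from `O`, outside `W`, to `D` either meets `D` outside `W` or crosses the boundary of
  -- `W`. Each of these sets has at most `w` vertices, too few for more than `2 * w` disjoint paths.
  have hend : ∀ i ∈ K, ∃ x ∈ f i, x ∈ G.outerBoundary W ∪ (D \ W) := by
    intro i hi
    by_contra! hno
    obtain ⟨x, hx, hxO⟩ := hfO i hi
    obtain ⟨y, hy, hyD⟩ := hfD i hi
    have hyW : y ∈ W := by
      by_contra hyW
      exact hno y hy (by simp [hyD, hyW])
    exact hO x hxO (chain_subset_of_disjoint_outerBoundary (hf i hi) ⟨y, hy, hyW⟩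
      (fun z hz hz' => hno z hz (by simp [hz'])) x hx)
  have : Nonempty V := by
    obtain ⟨i, hi⟩ := Finset.card_pos.1 (by omega : 0 < K.card)
    exact ⟨(hend i hi).choose⟩
  choose! e he heU using hend
  have hcard := Finset.card_le_card_of_injOn e heU fun i hi j hj hij => by
    by_contra hne
    exact hd i hi j hj hne (he i hi) (hij ▸ he j hj)
  have := Finset.card_union_le (G.outerBoundary W) (D \ W)
  omega

theorem exists_sorted_family {r : ℕ} (pos : Fin r → ℕ) (hpos : Function.Injective pos) :
    ∃ σ : Fin r → Fin r, Function.Injective σ ∧ StrictMono (pos ∘ σ) :=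
  ⟨Tuple.sort pos, (Tuple.sort pos).injective,
    (Tuple.monotone_sort pos).strictMono_of_injective (hpos.comp (Tuple.sort pos).injective)⟩

open Classical in
theorem IsElusive.exists_linked_cycle (h : G.IsElusive F N) {xs ys : List V}
    (hxs : G.PathList xs) (hys : G.PathList ys) (hxy : ∀ x ∈ xs, x ∉ ys)
    (hX : G.Linked F xs.toFinset (4 * w + 1)) (hY : G.Linked F ys.toFinset (4 * w + 1))
    (hN : 2 * (4 * w + 1) ≤ N) (hn : Fintype.card V < w * w) :
    ∃ O, G.CycleList O ∧ O.length ≤ xs.length + ys.length + 2 * w ∧ 2 * w ≤ O.length ∧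
      G.Linked F O.toFinset (w + 1) := by
  -- The paths are led to an independent subset `D` of `ys`, so that
  -- `IsElusive.linked_of_disjoint_paths` applies at the end.
  obtain ⟨D, hDY, hDc, hD⟩ := h.exists_linked_subset_card_eq hY hN
  obtain ⟨f₀, hf₀, hd₀⟩ := h.exists_disjoint_paths hX hD (by omega)
  have hf₀' : ∀ i, G.PathBetween xs.toFinset ys.toFinset (f₀ i) := fun i => by
    obtain ⟨h1, h2, b, hb, hb'⟩ := hf₀ i
    exact ⟨h1, h2, b, hDY hb, hb'⟩
  have hclean := fun i => (hf₀' i).exists_clean fun x hx hx' => hxy x (by simpa using hx)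
    (by simpa using hx')
  choose u₀ p₀ m₀ y₀ t₀ hfe₀ hp₀ hy₀ hm₀ hP₀ using hclean
  obtain ⟨σ, hσ, hmono⟩ := exists_sorted_family (fun i => xs.idxOf (p₀ i)) (by
    intro i j hij
    have := (List.idxOf_inj (by simpa using hp₀ i)).1 hij
    by_contra hne
    refine hd₀ hne (a := p₀ i) ?_ ?_
    · rw [hfe₀]; simp
    · rw [hfe₀ j, this]; simp)
  have hdis : ∀ i j x, i ≠ j → x ∈ f₀ (σ i) → x ∉ f₀ (σ j) := fun i j x hij hx hx' =>
    hd₀ (fun h => hij (hσ h)) hx hx'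
  have hfD : ∀ i, ∃ x ∈ f₀ (σ i), x ∈ D := fun i => by
    obtain ⟨b, hb, hb'⟩ := (hf₀ (σ i)).2.2
    exact ⟨b, List.mem_of_mem_getLast? hb', hb⟩
  have hfc : ∀ i, (f₀ (σ i)).IsChain G.Adj := fun i => (hf₀ (σ i)).1.1
  -- From here on the paths are numbered in the order of their ends on `xs`.
  obtain ⟨f, hf⟩ : ∃ f : Fin (4 * w + 1) → List V, ∀ i, f i = f₀ (σ i) := ⟨_, fun _ => rfl⟩
  obtain ⟨p, hp⟩ : ∃ p : Fin (4 * w + 1) → V, ∀ i, p i = p₀ (σ i) := ⟨_, fun _ => rfl⟩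
  obtain ⟨m, hm⟩ : ∃ m : Fin (4 * w + 1) → List V, ∀ i, m i = m₀ (σ i) := ⟨_, fun _ => rfl⟩
  obtain ⟨y, hy⟩ : ∃ y : Fin (4 * w + 1) → V, ∀ i, y i = y₀ (σ i) := ⟨_, fun _ => rfl⟩
  have hmemf : ∀ i x, x = p i ∨ x ∈ m i ∨ x = y i → x ∈ f i := by
    intro i x hx; rw [hf, hfe₀, ← hp, ← hm, ← hy]; simp; tauto
  have hP : ∀ i, G.PathList (p i :: m i ++ [y i]) := fun i => by
    rw [hp, hm, hy]; exact hP₀ _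
  have hmX : ∀ i, ∀ x ∈ m i, x ∉ xs ∧ x ∉ ys := fun i x hx => by
    have := hm₀ (σ i) x (by rwa [← hm])
    simpa using this
  have hpX : ∀ i, p i ∈ xs := fun i => by rw [hp]; simpa using hp₀ (σ i)
  have hyY : ∀ i, y i ∈ ys := fun i => by rw [hy]; simpa using hy₀ (σ i)
  have hpmono : StrictMono fun i => xs.idxOf (p i) := by
    intro i j hij
    have := hmono hij
    simpa [hp] using this
  simp only [← hf] at hdis hfD hfc
  clear hmono hp hm hy hf hfe₀ hp₀ hy₀ hm₀ hP₀
  have hmd : ∀ i, (m i).Nodup := fun i => by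
    have := (hP i).2
    exact this.sublist (by simp)
  have hmdis : ∀ i j, i ≠ j → (m i).Disjoint (m j) := fun i j hij x hx hx' =>
    hdis i j x hij (hmemf i x (by simp [hx])) (hmemf j x (by simp [hx']))
  -- One short path among the first `w` and one among the last `w` leave at least `2 * w + 1` paths
  -- strictly between them.
  obtain ⟨i₀, hi₀⟩ := exists_short_of_disjoint hn
    (fun i : Fin w => m ⟨i, by omega⟩) (fun i => hmd _)
    (fun i j hij => hmdis _ _ (by simpa [Fin.ext_iff] using hij))
  obtain ⟨j₀, hj₀⟩ := exists_short_of_disjoint hn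
    (fun i : Fin w => m ⟨3 * w + 1 + i, by omega⟩) (fun i => hmd _)
    (fun i j hij => hmdis _ _ (by simpa [Fin.ext_iff] using hij))
  obtain ⟨i, hi⟩ : ∃ i : Fin (4 * w + 1), i = ⟨i₀, by omega⟩ := ⟨_, rfl⟩
  obtain ⟨j, hj⟩ : ∃ j : Fin (4 * w + 1), j = ⟨3 * w + 1 + j₀, by omega⟩ := ⟨_, rfl⟩
  rw [← hi] at hi₀
  rw [← hj] at hj₀
  have hiw : (i : ℕ) < w := by rw [hi]; exact i₀.2
  have hjw : 3 * w + 1 ≤ (j : ℕ) := by rw [hj]; simp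
  have hij : i < j := by rw [Fin.lt_def]; omega
  obtain ⟨x₁, xm, x₃, hxe, -, -⟩ := exists_split_of_idxOf_lt (hpX j) (hpmono hij)
  have hyij : y j ≠ y i := fun he =>
    hdis i j (y i) hij.ne (hmemf i _ (by simp)) (hmemf j _ (by simp [he]))
  obtain ⟨yd, hyd, hydY, hydl⟩ := exists_path_within hys (hyY j) (hyY i) hyij
  have hbetween : ∀ k, i ≤ k → k ≤ j → p k ∈ p i :: xm ++ [p j] := fun k hik hkj =>
    mem_between_of_idxOf_le hxe hxs.2 (hpX k) (hpmono.monotone hik) (hpmono.monotone hkj)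
  obtain ⟨O, hO⟩ : ∃ O, O = p i :: xm ++ p j :: (m j ++ y j :: (yd ++ y i :: (m i).reverse)) :=
    ⟨_, rfl⟩
  have hxmX : ∀ x, x = p i ∨ x ∈ xm ∨ x = p j → x ∈ xs := by
    intro x hx; rw [hxe]; simp; tauto
  have hydYs : ∀ x, x = y j ∨ x ∈ yd ∨ x = y i → x ∈ ys := by
    rintro x (rfl | hx | rfl)
    · exact hyY j
    · exact hydY x hx
    · exact hyY i
  have hcycle : G.CycleList O := by
    rw [hO]
    refine cycleList_glue (X := {x | x ∈ xs}) (Y := {x | x ∈ ys}) hxy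
      (hxs.infix ⟨x₁, x₃, by simp [hxe]⟩) hyd (hP i) (hP j) (fun x hx => hxmX x ?_)
      (fun x hx => hydYs x ?_) (hmX i) (hmX j) (fun x hx hx' => hdis i j x hij.ne
        (hmemf i x ?_) (hmemf j x ?_))
    · simp at hx; tauto
    · simp at hx; tauto
    · simp at hx; tauto
    · simp at hx'; tauto
  refine ⟨O, hcycle, ?_, ?_, ?_⟩
  · have h1 := congrArg List.length hxe
    rw [hO]
    simp at h1 ⊢
    omega
  · have hcard := Finset.card_le_card_of_injOn (s := Finset.Icc i j) (t := O.toFinset) p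
      (fun k hk => by
        have hk' := Finset.mem_Icc.1 (by simpa using hk)
        have := hbetween k hk'.1 hk'.2
        rw [hO]
        simp at this ⊢
        tauto) (fun k _ l _ hkl => hpmono.injective (by simp [hkl]))
    rw [Fin.card_Icc] at hcard
    have := List.toFinset_card_le O
    omega
  -- Every path numbered from `i` to `j` starts on the stretch of `xs` that belongs to `O`.
  · refine h.linked_of_disjoint_paths (D := D) (K := Finset.Icc i j) (f := f) (by rwa [hDc])
      (by omega) (fun k _ => hfc k) (fun k hk => ⟨p k, hmemf k _ (by simp), ?_⟩)
      (fun k _ => hfD k) (fun k _ l _ hkl x hx hx' => hdis k l x hkl hx hx') ?_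
    · have hk' := Finset.mem_Icc.1 hk
      have := hbetween k hk'.1 hk'.2
      rw [hO]
      simp at this ⊢
      tauto
    · rw [Fin.card_Icc]; omega

end

/-! ### Cutting a path into pieces, and the choice of parameters -/

theorem mem_take_drop_iff {l : List V} {a b : ℕ} {x : V} :
    x ∈ (l.drop a).take b ↔ ∃ k, a ≤ k ∧ k < a + b ∧ l[k]? = some x := by
  rw [List.mem_iff_getElem?]
  constructor
  · rintro ⟨i, hi⟩
    rw [List.getElem?_take] at hi
    split_ifs at hi with h
    rw [List.getElem?_drop] at hi
    exact ⟨a + i, by omega, by omega, hi⟩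
  · rintro ⟨k, h1, h2, h3⟩
    refine ⟨k - a, ?_⟩
    rw [List.getElem?_take, if_pos (by omega), List.getElem?_drop, Nat.add_sub_cancel' h1]
    exact h3

theorem not_mem_take_drop_of_ne {l : List V} (hl : l.Nodup) {i j L : ℕ} (hij : i ≠ j) {x : V}
    (hx : x ∈ (l.drop (i * L)).take L) : x ∉ (l.drop (j * L)).take L := by
  intro hx'
  obtain ⟨k, h1, h2, h3⟩ := mem_take_drop_iff.1 hx
  obtain ⟨k', h1', h2', h3'⟩ := mem_take_drop_iff.1 hx'
  have hk : k < l.length := by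
    by_contra h
    simp [List.getElem?_eq_none (not_lt.1 h)] at h3
  have : k = k' := (List.getElem?_inj hk hl).1 (h3.trans h3'.symm)
  subst this
  have e1 : k / L = i := Nat.div_eq_of_lt_le h1 (by rw [Nat.succ_mul]; exact h2)
  have e2 : k / L = j := Nat.div_eq_of_lt_le h1' (by rw [Nat.succ_mul]; exact h2')
  exact hij (e1.symm.trans e2)

/-- With `s = √n` rounded down and `w = s + 1`, the three bounds say that the cycle has fewer than
`N` vertices, that an independent set of size `4 * w + 1` exists, and that one piece plus a boundary
of size `4 * w` for each piece has fewer than `N` vertices. -/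
theorem parameter_bounds {N n s : ℕ} (hNn : N ≤ n) (h : 4096 * n ^ 3 < N ^ 4)
    (hs : s * s ≤ n) (hs' : n < (s + 1) * (s + 1)) :
    2 * (N / 3) + 2 * (s + 1) < N ∧ 2 * (4 * (s + 1) + 1) ≤ N ∧
      N / 3 + (n / (N / 3) + 1) * (4 * (s + 1)) < N := by
  have hn0 : 0 < n := by
    rcases Nat.eq_zero_or_pos n with rfl | h0
    · have : N = 0 := by omega
      subst this; simp at h
    · exact h0
  have hn : 4096 < n := by
    have h1 : N ^ 4 ≤ n ^ 4 := Nat.pow_le_pow_left hNn 4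
    have h2 : 4096 * n ^ 3 < n * n ^ 3 := by nlinarith
    exact lt_of_mul_lt_mul_right h2 (Nat.zero_le _)
  have hs64 : 64 ≤ s := by
    by_contra hlt
    have : (s + 1) * (s + 1) ≤ 64 * 64 := Nat.mul_le_mul (by omega) (by omega)
    omega
  -- The square root of the hypothesis, since `4096 = 64 ^ 2` and `s * s ≤ n`.
  have hN2 : 64 * n * s < N * N := by
    by_contra! hle
    have h1 : (N * N) * (N * N) ≤ (64 * n * s) * (64 * n * s) := Nat.mul_le_mul hle hle
    have h2 : (64 * n * s) * (64 * n * s) = 4096 * n ^ 2 * (s * s) := by ring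
    have h3 : 4096 * n ^ 2 * (s * s) ≤ 4096 * n ^ 2 * n := Nat.mul_le_mul_left _ hs
    have h4 : 4096 * n ^ 2 * n = 4096 * n ^ 3 := by ring
    have h5 : (N * N) * (N * N) = N ^ 4 := by ring
    omega
  have hNs : 64 * s < N := by
    have h1 : N * N ≤ n * N := Nat.mul_le_mul_right _ hNn
    have h2 : n * (64 * s) < n * N := by
      calc n * (64 * s) = 64 * n * s := by ring
        _ < n * N := hN2.trans_le h1
    exact lt_of_mul_lt_mul_left h2 (Nat.zero_le _)
  set L := N / 3 with hL
  have hL4 : N ≤ 4 * L := by omega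
  set q := n / L with hq
  have hqL : q * L ≤ n := Nat.div_mul_le_self n L
  have hq16 : 16 * (q * s) < N := by
    have h1 : N * (16 * (q * s)) ≤ 64 * n * s := by
      calc N * (16 * (q * s)) ≤ (4 * L) * (16 * (q * s)) := Nat.mul_le_mul_right _ hL4
        _ = 64 * (q * L) * s := by ring
        _ ≤ 64 * n * s := by gcongr
    exact lt_of_mul_lt_mul_left (h1.trans_lt hN2) (Nat.zero_le _)
  have hqs : 64 * q ≤ q * s := by rw [mul_comm]; exact Nat.mul_le_mul_left _ hs64
  have he : (q + 1) * (4 * (s + 1)) = 4 * (q * s) + 4 * q + 4 * s + 4 := by ring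
  refine ⟨by omega, by omega, ?_⟩
  rw [he]
  omega

section

variable [Fintype V] {G : SimpleGraph V} {F : Set (Finset V)} {N : ℕ}

open Classical in
theorem IsElusive.pow_four_le (h : G.IsElusive F N)
    (hF : ∀ A ∈ F, ∃ l, G.PathList l ∧ l.toFinset = A ∧ G.Taut l) :
    N ^ 4 ≤ 4096 * Fintype.card V ^ 3 := by
  by_contra! hlt
  have hNn : N ≤ Fintype.card V := by
    by_contra! hn
    obtain ⟨A, hA, hAd⟩ := h.avoid Finset.univ hn
    obtain ⟨x, hx, -⟩ := h.inter A hA A hA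
    exact hAd x hx (Finset.mem_univ x)
  set n := Fintype.card V with hn
  have hw : n < (n.sqrt + 1) * (n.sqrt + 1) := Nat.lt_succ_sqrt n
  obtain ⟨h1, h2, h3⟩ := parameter_bounds hNn hlt (Nat.sqrt_le n) hw
  set w := n.sqrt + 1 with hwdef
  set L := N / 3 with hL
  have hLpos : 0 < L := by omega
  obtain ⟨A, hA, -⟩ := h.avoid ∅ (by simp; omega)
  obtain ⟨P, hP, hPA, -⟩ := hF A hA
  have hPlen : P.length ≤ n := by
    rw [← List.toFinset_card_of_nodup hP.2]
    exact Finset.card_le_univ _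
  set M := n / L + 1 with hM
  set I : ℕ → List V := fun i => (P.drop (i * L)).take L with hI
  have hIlen : ∀ i, (I i).length ≤ L := fun i => List.length_take_le _ _
  have hcov : ∀ x ∈ A, ∃ i ∈ Finset.range M, x ∈ (I i).toFinset := by
    intro x hx
    rw [← hPA, List.mem_toFinset, List.mem_iff_getElem?] at hx
    obtain ⟨k, hk⟩ := hx
    have hkl : k < P.length := by
      by_contra h
      simp [List.getElem?_eq_none (not_lt.1 h)] at hk
    refine ⟨k / L, ?_, ?_⟩
    · rw [Finset.mem_range, hM, Nat.lt_succ_iff]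
      exact Nat.div_le_div_right (by omega)
    · rw [List.mem_toFinset, hI, mem_take_drop_iff]
      exact ⟨k, Nat.div_mul_le_self k L, by
        have := Nat.lt_div_mul_add (a := k) hLpos
        omega, hk⟩
  -- The covering lemma is used twice, the second time with the piece already found as exceptional
  -- set, which yields a second linked piece.
  obtain ⟨i, hi, hiL⟩ := h.exists_linked_of_cover (s := Finset.range M)
    (I := fun i => (I i).toFinset) (r := 4 * w) hA ∅ (fun x hx => Or.inr (hcov x hx))
    (by simp; omega)
  obtain ⟨j, hj, hjL⟩ := h.exists_linked_of_cover (s := (Finset.range M).erase i)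
    (I := fun i => (I i).toFinset) (r := 4 * w) hA (I i).toFinset (fun x hx => by
      obtain ⟨k, hk, hxk⟩ := hcov x hx
      by_cases hki : k = i
      · exact Or.inl (hki ▸ hxk)
      · exact Or.inr ⟨k, Finset.mem_erase.2 ⟨hki, hk⟩, hxk⟩)
    (by
      have e1 := (List.toFinset_card_le (I i)).trans (hIlen i)
      have e2 : ((Finset.range M).erase i).card * (4 * w) ≤ M * (4 * w) :=
        Nat.mul_le_mul_right _ ((Finset.card_erase_le).trans (by simp))
      omega)
  have hji : j ≠ i := (Finset.mem_erase.1 hj).1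
  have hinf : ∀ i, I i <:+: P := fun i =>
    (List.take_prefix _ _).isInfix.trans (List.drop_suffix _ _).isInfix
  obtain ⟨O, hO, hO1, hO2, hO3⟩ := h.exists_linked_cycle (hP.infix (hinf i)) (hP.infix (hinf j))
    (fun x hx => not_mem_take_drop_of_ne hP.2 hji.symm hx) hiL hjL h2 hw
  have e1 := hIlen i
  have e2 := hIlen j
  exact h.false_of_cycle hF hO (by omega) hO2 hO3 (by omega) hw.le

/-- The constant is the fourth root of 4096, namely 8. It would do for cycles too. -/
theorem cast_le_of_pow_four_le {N n c : ℕ} (hc : 8 ≤ c) (h : N ^ 4 ≤ 4096 * n ^ 3) :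
    (N : ℝ) ≤ c * (n : ℝ) ^ (3 / 4 : ℝ) := by
  have h0 : (0 : ℝ) ≤ (n : ℝ) ^ (3 / 4 : ℝ) := by positivity
  have h1 : ((n : ℝ) ^ (3 / 4 : ℝ)) ^ 4 = (n : ℝ) ^ 3 := by
    rw [← Real.rpow_natCast, ← Real.rpow_mul (by positivity)]
    norm_num
  have h2 : (N : ℝ) ^ 4 ≤ (8 * (n : ℝ) ^ (3 / 4 : ℝ)) ^ 4 := by
    rw [mul_pow, h1]
    norm_num
    exact_mod_cast h
  have h3 := le_of_pow_le_pow_left₀ (by norm_num) (by positivity) h2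
  have h4 : (8 : ℝ) ≤ c := by exact_mod_cast hc
  exact h3.trans (mul_le_mul_of_nonneg_right h4 h0)

end

/-! ### Longest paths and cycles are taut and intersect pairwise -/

theorem PathList.detour {G : SimpleGraph V} {l₁ m l₃ d : List V} {a b : V}
    (hl : G.PathList (l₁ ++ a :: m ++ b :: l₃)) (hd : G.PathList (a :: d ++ [b]))
    (hdl : ∀ x ∈ d, x ∉ l₁ ++ a :: m ++ b :: l₃) : G.PathList (l₁ ++ a :: (d ++ b :: l₃)) := by
  have hdis := hl.2
  have hd1 : ∀ x ∈ d, x ∉ l₁ ∧ x ∉ l₃ := fun x hx => by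
    have := hdl x hx
    simp at this
    tauto
  have hb1 : b ∉ l₁ := by grind [List.nodup_append]
  have ha3 : a ∉ l₃ := by grind [List.nodup_append]
  have h13 : l₁.Disjoint l₃ := by
    intro x hx hx'
    grind [List.nodup_append]
  refine pathList_append_cons.2 ⟨hl.infix ⟨[], m ++ b :: l₃, by simp⟩, ?_, fun x hx hx' => ?_⟩
  · rw [← List.cons_append]
    refine pathList_append_cons.2 ⟨hd, hl.infix ⟨l₁ ++ a :: m, [], by simp⟩, fun x hx hx' => ?_⟩
    rcases List.mem_cons.1 hx with rfl | hx
    · exact ha3 hx'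
    · exact (hd1 x hx).2 hx'
  · simp only [List.mem_append, List.mem_cons] at hx'
    rcases hx' with hx' | rfl | hx'
    · exact (hd1 x hx').1 hx
    · exact hb1 hx
    · exact h13 hx hx'

theorem pathBetween_of_walk {G : SimpleGraph V} {u v : V} {p : G.Walk u v} (hp : p.IsPath)
    {A B : Finset V} (hu : u ∈ A) (hv : v ∈ B) : G.PathBetween A B p.support := by
  refine ⟨⟨p.isChain_adj_support, hp.support_nodup⟩, ⟨u, hu, ?_⟩, v, hv, ?_⟩
  · rw [Option.mem_def, List.head?_eq_some_head p.support_ne_nil, Walk.head_support]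
  · rw [Option.mem_def, List.getLast?_eq_some_getLast p.support_ne_nil, Walk.getLast_support]

/-- A path list with the maximum number of vertices. -/
def IsMaxPathList (G : SimpleGraph V) (l : List V) : Prop :=
  G.PathList l ∧ ∀ l', G.PathList l' → l'.length ≤ l.length

/-- A cycle list with the maximum number of vertices. -/
def IsMaxCycleList (G : SimpleGraph V) (l : List V) : Prop :=
  G.CycleList l ∧ 3 ≤ l.length ∧ ∀ l', G.CycleList l' → 3 ≤ l'.length → l'.length ≤ l.length

theorem IsLongestPath.isMaxPathList {G : SimpleGraph V} {u v : V} {p : G.Walk u v}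
    (hp : G.IsLongestPath p) : G.IsMaxPathList p.support := by
  refine ⟨⟨p.isChain_adj_support, hp.1.support_nodup⟩, fun l hl => ?_⟩
  rcases eq_or_ne l [] with rfl | hne
  · simp
  · have := hp.2 _ _ (Walk.ofSupport l hne hl.1) (Walk.IsPath.mk' (by
      rw [Walk.support_ofSupport]; exact hl.2))
    rw [Walk.length_ofSupport] at this
    rw [Walk.length_support]
    omega

theorem IsMaxPathList.taut {G : SimpleGraph V} {l : List V} (h : G.IsMaxPathList l) :
    G.Taut l := by
  rintro l₁ a m b l₃ d rfl hd hdl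
  have := h.2 _ (h.1.detour hd hdl)
  simp at this
  omega

/-- A detour inside the list keeps its first and last vertices, hence also the closing edge. -/
theorem IsMaxCycleList.taut {G : SimpleGraph V} {l : List V} (h : G.IsMaxCycleList l) :
    G.Taut l := by
  rintro l₁ a m b l₃ d rfl hd hdl
  by_contra! hlt
  have := h.2.2 _ ⟨h.1.1.detour hd hdl, fun x hx y hy => h.1.2 x ?_ y ?_⟩ (by simp; omega)
  · simp at this
    omega
  · rw [head?_append_cons] at hx
    rw [List.append_assoc, List.cons_append, head?_append_cons]
    exact hx
  · rw [← List.cons_append, ← List.append_assoc,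
      List.getLast?_append_of_ne_nil _ (by simp)] at hy
    rw [List.getLast?_append_of_ne_nil _ (by simp)]
    exact hy

theorem PathList.exists_half {G : SimpleGraph V} {l : List V} (hl : G.PathList l) {a : V}
    (ha : a ∈ l) :
    ∃ H, G.PathList (H ++ [a]) ∧ (∀ x ∈ H, x ∈ l) ∧ l.length ≤ 2 * H.length + 1 := by
  obtain ⟨l₁, l₂, rfl⟩ := List.append_of_mem ha
  by_cases h : l₂.length ≤ l₁.length
  · exact ⟨l₁, hl.infix ⟨[], l₂, by simp⟩, fun x hx => by simp [hx], by simp; omega⟩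
  · refine ⟨l₂.reverse, ?_, fun x hx => by
      rw [List.mem_reverse] at hx
      simp [hx], by simp; omega⟩
    have := (hl.infix (m := a :: l₂) ⟨l₁, [], by simp⟩).reverse
    simpa using this

open Classical in
/-- Any two longest paths of a connected graph share a vertex. -/
theorem IsMaxPathList.exists_mem_inter {G : SimpleGraph V} (hG : G.Connected) {l l' : List V}
    (hl : G.IsMaxPathList l) (hl' : G.IsMaxPathList l') : ∃ x ∈ l, x ∈ l' := by
  by_contra! hdis
  obtain ⟨v⟩ := hG.nonempty
  have hpos : ∀ l, G.IsMaxPathList l → ∃ x, x ∈ l := fun l hl => by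
    have := hl.2 [v] ⟨by simp, by simp⟩
    exact List.exists_mem_of_length_pos (by simp at this; omega)
  obtain ⟨x, hx⟩ := hpos l hl
  obtain ⟨y, hy⟩ := hpos l' hl'
  obtain ⟨p, hp⟩ := (hG.preconnected x y).exists_isPath
  obtain ⟨-, a, m, b, -, -, ha, hb, hm, hamb⟩ := (pathBetween_of_walk hp
    (A := l.toFinset) (B := l'.toFinset) (by simpa using hx) (by simpa using hy)).exists_clean
    (fun x hx hx' => hdis x (by simpa using hx) (by simpa using hx'))
  simp only [List.mem_toFinset] at ha hb hm
  -- The longer halves of the two paths, joined by the connecting path, have more vertices than the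
  -- average of the two paths.
  obtain ⟨H, hH, hHl, hHlen⟩ := hl.1.exists_half ha
  obtain ⟨K, hK, hKl, hKlen⟩ := hl'.1.exists_half hb
  have hK' : G.PathList (b :: K.reverse) := by simpa using hK.reverse
  have h1 : G.PathList (a :: m ++ b :: K.reverse) := by
    refine pathList_append_cons.2 ⟨hamb, hK', fun z hz hz' => ?_⟩
    have hz2 := hKl z (by simpa using hz')
    rcases List.mem_cons.1 hz with rfl | hz
    · exact hdis _ ha hz2
    · exact (hm z hz).2 hz2
  have h2 : G.PathList (H ++ a :: (m ++ b :: K.reverse)) := by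
    refine pathList_append_cons.2 ⟨hH, by simpa using h1, fun z hz hz' => ?_⟩
    have hz2 := hHl z hz
    simp only [List.mem_append, List.mem_cons, List.mem_reverse] at hz'
    rcases hz' with hz' | rfl | hz'
    · exact (hm z hz').1 hz2
    · exact hdis _ hz2 hb
    · exact hdis _ hz2 (hKl z hz')
  have h3 := hl.2 _ h2
  have h4 := hl'.2 _ h2
  simp at h3 h4
  omega

/-- The tail of the support is taken because the support lists the base vertex twice. -/
theorem IsLongestCycle.isMaxCycleList {G : SimpleGraph V} {u : V} {c : G.Walk u u}
    (hc : G.IsLongestCycle c) : G.IsMaxCycleList c.support.tail := by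
  obtain ⟨hc, hmax⟩ := hc
  have hlen : c.support.tail.length = c.length := by simp
  refine ⟨⟨⟨c.isChain_adj_support.tail, hc.support_nodup⟩, ?_⟩, ?_, fun l hl h3 => ?_⟩
  · cases c with
    | nil => simp at hc
    | cons h p =>
      intro a ha b hb
      rw [Walk.support_cons, List.tail_cons] at ha hb
      rw [Option.mem_def, List.head?_eq_some_head p.support_ne_nil, Walk.head_support,
        Option.some_inj] at ha
      rw [Option.mem_def, List.getLast?_eq_some_getLast p.support_ne_nil, Walk.getLast_support,
        Option.some_inj] at hb
      subst ha hb
      exact h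
  · rw [hlen]; exact hc.three_le_length
  · have hne : l ≠ [] := by rintro rfl; simp at h3
    have hadj : G.Adj (l.getLast hne) (l.head hne) :=
      hl.2 _ (List.head?_eq_some_head hne) _ (List.getLast?_eq_some_getLast hne)
    obtain ⟨p, hps, hpl⟩ : ∃ p : G.Walk (l.head hne) (l.getLast hne),
        p.support = l ∧ p.length = l.length - 1 :=
      ⟨Walk.ofSupport l hne hl.1.1, Walk.support_ofSupport _ _, Walk.length_ofSupport _ _⟩
    have hcyc : (Walk.cons hadj p).IsCycle := by
      rw [Walk.isCycle_iff_isPath_tail_and_le_length]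
      refine ⟨?_, ?_⟩
      · rw [Walk.isPath_def, Walk.support_tail_of_not_nil _ (by simp), Walk.support_cons,
          List.tail_cons, hps]
        exact hl.1.2
      · rw [Walk.length_cons, hpl]; omega
    have := hmax _ _ hcyc
    rw [Walk.length_cons, hpl] at this
    omega

open Classical in
theorem IsKConnected.exists_disjoint_paths [Fintype V] {G : SimpleGraph V} {k : ℕ}
    (hG : G.IsKConnected k) {A B : Finset V} (hA : k ≤ A.card) (hB : k ≤ B.card) :
    ∃ f : Fin k → List V, (∀ i, G.PathBetween A B (f i)) ∧
      Pairwise fun i j => (f i).Disjoint (f j) := by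
  refine G.menger A B k fun X Y hAX hBY hXY => ?_
  by_contra! hlt
  obtain ⟨a, ha, haS⟩ := Finset.exists_mem_notMem_of_card_lt_card (hlt.trans_le hA)
  obtain ⟨b, hb, hbS⟩ := Finset.exists_mem_notMem_of_card_lt_card (hlt.trans_le hB)
  have hconn := hG.2 (X ∩ Y) hlt
  obtain ⟨p⟩ := hconn.preconnected ⟨a, haS⟩ ⟨b, hbS⟩
  have haX := hAX ha
  have hbY := hBY hb
  have := chain_subset_of_closed (W := {v | v.1 ∈ X ∧ v.1 ∉ Y}) (K := Set.univ)
    (by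
      rintro u ⟨hu, hu'⟩ v - huv
      have h := hXY.2 u.1 v.1 huv hu hu'
      refine ⟨h, fun hvY => v.2 (Finset.mem_inter.2 ⟨h, hvY⟩)⟩)
    p.isChain_adj_support (fun x _ => Set.mem_univ x) (by
      intro x hx
      rw [List.head?_eq_some_head p.support_ne_nil, Walk.head_support, Option.mem_def,
        Option.some_inj] at hx
      subst hx
      exact ⟨haX, fun h => haS (Finset.mem_inter.2 ⟨haX, h⟩)⟩) _ p.end_mem_support
  exact this.2 hbY

open Classical in
/-- Any two longest cycles of a 2-connected graph share a vertex. -/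
theorem IsMaxCycleList.exists_mem_inter [Fintype V] {G : SimpleGraph V} (hG : G.IsKConnected 2)
    {l l' : List V} (hl : G.IsMaxCycleList l) (hl' : G.IsMaxCycleList l') :
    ∃ x ∈ l, x ∈ l' := by
  by_contra! hdis
  have hcard : ∀ l, G.IsMaxCycleList l → 2 ≤ l.toFinset.card := fun l hl => by
    rw [List.toFinset_card_of_nodup hl.1.1.2]
    have := hl.2.1
    omega
  obtain ⟨f, hf, hd⟩ := hG.exists_disjoint_paths (hcard l hl) (hcard l' hl')
  have hclean := fun i => (hf i).exists_clean fun x hx hx' =>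
    hdis x (by simpa using hx) (by simpa using hx')
  choose u a m b t hfe ha hb hm hp using hclean
  simp only [List.mem_toFinset] at ha hb hm
  have hmemf : ∀ i x, x ∈ a i :: m i ++ [b i] → x ∈ f i := by
    intro i x hx; rw [hfe]; simp at hx ⊢; tauto
  have h01 : (a 0 :: m 0 ++ [b 0]).Disjoint (a 1 :: m 1 ++ [b 1]) := fun x hx hx' =>
    hd (show (0 : Fin 2) ≠ 1 by decide) (hmemf 0 x hx) (hmemf 1 x hx')
  have haa : a 0 ≠ a 1 := fun h => h01 (a := a 0) (by simp) (by simp [h])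
  have hbb : b 1 ≠ b 0 := fun h => h01 (a := b 0) (by simp) (by simp [h])
  -- The longer arcs of the two cycles and the two connecting paths form a cycle longer than the
  -- average of the two.
  obtain ⟨d, hdp, hdl, hdlen⟩ := hl.1.exists_arc (ha 0) (ha 1) haa
  obtain ⟨e, hep, hel, helen⟩ := hl'.1.exists_arc (hb 1) (hb 0) hbb
  have hcyc := cycleList_glue (X := {x | x ∈ l}) (Y := {x | x ∈ l'}) hdis hdp hep (hp 0) (hp 1)
    (fun x hx => by
      simp at hx
      rcases hx with rfl | hx | rfl
      exacts [ha 0, hdl x hx, ha 1])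
    (fun x hx => by
      simp at hx
      rcases hx with rfl | hx | rfl
      exacts [hb 1, hel x hx, hb 0]) (hm 0) (hm 1) h01
  have h3 := hl.2.2 _ hcyc (by simp; omega)
  have h4 := hl'.2.2 _ hcyc (by simp; omega)
  simp at h3 h4
  omega

/-! ### From longest paths and cycles to elusive families -/

open Classical in
theorem isElusive_of_pathList [Fintype V] {G : SimpleGraph V} {N : ℕ} {Q : List V → Prop}
    (hQ : ∀ l, Q l → G.PathList l) (hinter : ∀ l l', Q l → Q l' → ∃ x ∈ l, x ∈ l')
    (havoid : ∀ T : Finset V, T.card < N → ∃ l, Q l ∧ ∀ x ∈ l, x ∉ T) :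
    G.IsElusive {A | ∃ l, Q l ∧ l.toFinset = A} N where
  inter := by
    rintro _ ⟨l, hl, rfl⟩ _ ⟨l', hl', rfl⟩
    simpa using hinter l l' hl hl'
  conn := by
    rintro _ ⟨l, hl, rfl⟩ W hW hd x hx
    simp only [List.mem_toFinset] at hW hd hx
    exact chain_subset_of_disjoint_outerBoundary (hQ l hl).1 hW hd x hx
  avoid T hT := by
    obtain ⟨l, hl, hlT⟩ := havoid T hT
    exact ⟨_, ⟨l, hl, rfl⟩, by simpa using hlT⟩

theorem pow_four_lpt_le [Fintype V] {G : SimpleGraph V} (hG : G.Connected) :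
    G.lpt ^ 4 ≤ 4096 * Fintype.card V ^ 3 := by
  classical
  refine (isElusive_of_pathList (Q := G.IsMaxPathList) (fun _ h => h.1)
    (fun _ _ hl hl' => hl.exists_mem_inter hG hl') fun T hT => ?_).pow_four_le ?_
  · have hno : ¬ G.IsLongestPathTransversal T := fun h =>
      Nat.notMem_of_lt_sInf hT ⟨T, h, rfl⟩
    unfold IsLongestPathTransversal at hno
    push Not at hno
    obtain ⟨u, v, p, hp, hpT⟩ := hno
    exact ⟨_, hp.isMaxPathList, fun x hx hxT => hpT x hxT hx⟩
  · rintro _ ⟨l, hl, rfl⟩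
    exact ⟨l, hl.1, rfl, hl.taut⟩

theorem pow_four_lct_le [Fintype V] {G : SimpleGraph V} (hG : G.IsKConnected 2) :
    G.lct ^ 4 ≤ 4096 * Fintype.card V ^ 3 := by
  classical
  refine (isElusive_of_pathList (Q := G.IsMaxCycleList) (fun _ h => h.1.1)
    (fun _ _ hl hl' => hl.exists_mem_inter hG hl') fun T hT => ?_).pow_four_le ?_
  · have hno : ¬ G.IsLongestCycleTransversal T := fun h =>
      Nat.notMem_of_lt_sInf hT ⟨T, h, rfl⟩
    unfold IsLongestCycleTransversal at hno
    push Not at hno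
    obtain ⟨u, c, hc, hcT⟩ := hno
    exact ⟨_, hc.isMaxCycleList, fun x hx hxT => hcT x hxT (List.mem_of_mem_tail hx)⟩
  · rintro _ ⟨l, hl, rfl⟩
    exact ⟨l, hl.1.1, rfl, hl.taut⟩

end SimpleGraph

theorem corollary2 {V : Type*} [Fintype V] (G : SimpleGraph V) :
    (G.Connected → (G.lpt : ℝ) ≤ 8 * (Fintype.card V : ℝ) ^ (3 / 4 : ℝ)) ∧
    (G.IsKConnected 2 → (G.lct : ℝ) ≤ 20 * (Fintype.card V : ℝ) ^ (3 / 4 : ℝ)) :=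
  ⟨fun hG => by
    exact_mod_cast SimpleGraph.cast_le_of_pow_four_le (c := 8) (by norm_num)
      (SimpleGraph.pow_four_lpt_le hG),
  fun hG => by
    exact_mod_cast SimpleGraph.cast_le_of_pow_four_le (c := 20) (by norm_num)
      (SimpleGraph.pow_four_lct_le hG)⟩
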